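/- Let $n\ge 3$, let $G=(V,E)$ be the complete graph on $V=\{1,\dots,n\}$, let the edge weights be independent exponential random variables with parameter $1$, and let $d(u,v)$ be the minimum total weight of a $u,v$-path. Let $0<f_1\le f_2\le\dots\le f_n$ be deterministic opening costs (possibly depending on $n$) and put $F_k=\sum_{i=1}^k f_i$. For $\varnothing\ne U\subseteq V$ let $c(U)=\sum_{u\in U}f_u+\sum_{v\in V}\min_{u\in U}d(u,v)$, and let $\mathsf{OPT}=\min_{\varnothing\neq U\subseteq V}c(U)$. Define $\kappa=\max\{i\in\{1,\dots,n\}: f_i<1/(i-1)\}$ (with $1/0=\infty$), and let $\mathsf{ALG}=c(U)$, where $U$ is a set of $\kappa$ cheapest facilities, chosen independently of the edge weights, ties being broken arbitrarily. For $C>0$ put $$B_C=\sqrt{\max\left\{\frac1{F_n^2},\ \max_{1\le k\le n-1}C\cdot\frac{n^4F_{n-k}+kn^2}{n^4F_{n-k}^3+k^4F_{n-k}}\right\}}+\sqrt[4]{C\left(\frac{n^6F_{n-1}^2+n^2}{n^8F_{n-1}^7+F_{n-1}^3}+\frac{n^{10}F_{n-2}^3+n^4}{n^{14}F_{n-2}^9+F_{n-2}^2}+\sum_{k=3}^{n-1}\frac{k^3n^{12}F_{n-k}^3+k^9n^6}{n^{16}F_{n-k}^9+k^{16}F_{n-k}}\right)}.$$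 Theorem. If $\kappa=\Theta(n)$, then, for some constant $C$ and all sufficiently large $n$, the expectation $\mathbb{E}[\mathsf{ALG}/\mathsf{OPT}]$ is finite and $$\mathbb{E}\left[\frac{\mathsf{ALG}}{\mathsf{OPT}}\right]\le B_C .$$ Moreover, if $\kappa=n$, then also $$\mathbb{E}\left[\frac{\mathsf{ALG}}{\mathsf{OPT}}\right]\le F_n\cdot B_C .$$ Precisely: for every $c>0$ there are $C>0$ and $N$, depending only on $c$, such that these bounds hold for all $n\ge N$ and all such opening costs with $\kappa\ge cn$. -/

import Mathlib

open MeasureTheory ProbabilityTheory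

namespace FacLoc

noncomputable section

/-- The edges of the complete graph on the `n` vertices `Fin n`. -/
abbrev Edge (n : ℕ) : Type := (⊤ : SimpleGraph (Fin n)).edgeSet

/-- The joint law of the edge weights: independent, exponential with parameter `1`. -/
def weightLaw (n : ℕ) : Measure (Edge n → ℝ) :=
  Measure.pi fun _ : Edge n => expMeasure 1

/-- The total weight of a walk in the complete graph. -/
def walkWeight {n : ℕ} (w : Edge n → ℝ) {u v : Fin n}
    (p : (⊤ : SimpleGraph (Fin n)).Walk u v) : ℝ :=
  (p.edges.attach.map fun e => w ⟨e.1, p.edges_subset_edgeSet e.2⟩).sum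

/-- The random shortest path metric: `dist w u v` is the minimum total weight of a path from
`u` to `v` in the complete graph (there are finitely many paths, and at least one). -/
def dist {n : ℕ} (w : Edge n → ℝ) (u v : Fin n) : ℝ :=
  ⨅ p : (⊤ : SimpleGraph (Fin n)).Path u v, walkWeight w p.1

/-- The total cost `c(U)` of opening the set `U` of facilities (meaningful for nonempty `U`):
opening costs plus the sum over all vertices of the distance to the nearest open facility. -/
def cost {n : ℕ} (f : Fin n → ℝ) (w : Edge n → ℝ) (U : Finset (Fin n)) : ℝ :=
  ∑ u ∈ U, f u + ∑ v : Fin n, ⨅ u : {u : Fin n // u ∈ U}, dist w u.1 v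

/-- The cost of an optimal solution: the minimum of `c(U)` over all nonempty sets `U`. -/
def OPT {n : ℕ} (f : Fin n → ℝ) (w : Edge n → ℝ) : ℝ :=
  ⨅ U : {U : Finset (Fin n) // U.Nonempty}, cost f w U.1

/-- `κ = max {i ∈ {1, …, n} : f_i < 1 / (i - 1)}`, with `1 / 0 = ∞`. The vertex `j : Fin n` is
the one that is numbered `i = j + 1` in `{1, …, n}`. -/
def kappa {n : ℕ} (f : Fin n → ℝ) : ℕ :=
  open Classical in
  (Finset.univ.filter fun j : Fin n => j.val = 0 ∨ f j < 1 / (j.val : ℝ)).sup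
    fun j => j.val + 1

/-- `U` consists of `κ` cheapest facilities, ties being broken in any way. -/
def IsGreedy {n : ℕ} (f : Fin n → ℝ) (U : Finset (Fin n)) : Prop :=
  U.card = kappa f ∧ ∀ u ∈ U, ∀ v ∉ U, f u ≤ f v

/-- `F_k = f_1 + ⋯ + f_k`. -/
def F {n : ℕ} (f : Fin n → ℝ) (k : ℕ) : ℝ :=
  ∑ j : Fin n with j.val < k, f j

/-- The `k`-th term of the maximum. -/
def maxTerm {n : ℕ} (f : Fin n → ℝ) (k : ℕ) : ℝ :=
  ((n : ℝ) ^ 4 * F f (n - k) + k * (n : ℝ) ^ 2) /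
    ((n : ℝ) ^ 4 * F f (n - k) ^ 3 + (k : ℝ) ^ 4 * F f (n - k))

/-- The sum below the fourth root. -/
def rootSum {n : ℕ} (f : Fin n → ℝ) : ℝ :=
  ((n : ℝ) ^ 6 * F f (n - 1) ^ 2 + (n : ℝ) ^ 2) /
      ((n : ℝ) ^ 8 * F f (n - 1) ^ 7 + F f (n - 1) ^ 3) +
    ((n : ℝ) ^ 10 * F f (n - 2) ^ 3 + (n : ℝ) ^ 4) /
      ((n : ℝ) ^ 14 * F f (n - 2) ^ 9 + F f (n - 2) ^ 2) +
    ∑ k ∈ Finset.Icc 3 (n - 1),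
      ((k : ℝ) ^ 3 * (n : ℝ) ^ 12 * F f (n - k) ^ 3 + (k : ℝ) ^ 9 * (n : ℝ) ^ 6) /
        ((n : ℝ) ^ 16 * F f (n - k) ^ 9 + (k : ℝ) ^ 16 * F f (n - k))

/-- The closed-form bound; `C` is the constant of the O-notation. -/
def ratioBound {n : ℕ} (C : ℝ) (f : Fin n → ℝ) : ℝ :=
  Real.sqrt (max (1 / F f n ^ 2) (⨆ k : {k : ℕ // k ∈ Finset.Icc 1 (n - 1)}, C * maxTerm f k.1)) +
    (C * rootSum f) ^ (1 / 4 : ℝ)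

end

end FacLoc

namespace FacLoc

/-! By Cauchy-Schwarz, `E[ALG/OPT]` is at most the product of the `L²` norms of `ALG` and `1/OPT`.

The norm of `ALG` is bounded in terms of `c`: the `κ` facilities cost at most `κ/(κ-1) ≤ 2`, and
each vertex connects at cost at most the minimum of `κ` independent exponentials, whose second
moment is `2/κ²` (`integral_cost_greedy_sq_le`).

For `1/OPT`, assign to each of the `k` closed facilities the last edge of a shortest path from an
open one. These edges are distinct, so `OPT ≥ F_{n-k} + w(A)` for some set `A` of `k` edges
(`exists_edges_le_OPT`). Unless `w(A)` is below order `k²/n²` while `F_{n-k}` is also small, the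
maximum in the bound controls `1/OPT²`. In the exceptional case, sum the fourth power of `1/(F_{n-k}
+ w(A))` over all `A`. A sum of `k` weights has density at most `s^(k-1)/(k-1)!` and there are at
most `n^(2k)/k!` sets, so the expectation is at most a constant times `rootSum`
(`lintegral_totalExcess_le`). The square root of that sum bounds `1/OPT²`, whence the fourth root in
the bound (`integral_inv_OPT_sq_le`).

The factor `‖ALG‖` must finally be absorbed into `C`, although `1/F_n²` carries no constant. If `F_n
≥ 1/n`, that entry is dominated by the `k = 1` term. Otherwise `κ = n`, and then `ALG = F_n ≤ 1`
almost surely. -/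

/-! ### Walk weights and the shortest path metric. -/

/-- Edge weights extended by zero to all unordered pairs. -/
noncomputable def extWeight {n : ℕ} (w : Edge n → ℝ) (e : Sym2 (Fin n)) : ℝ :=
  open Classical in
  if h : e ∈ (⊤ : SimpleGraph (Fin n)).edgeSet then w ⟨e, h⟩ else 0

lemma extWeight_of_mem {n : ℕ} (w : Edge n → ℝ) {e : Sym2 (Fin n)}
    (h : e ∈ (⊤ : SimpleGraph (Fin n)).edgeSet) : extWeight w e = w ⟨e, h⟩ := by
  simp only [extWeight, dif_pos h]

lemma extWeight_nonneg {n : ℕ} {w : Edge n → ℝ} (hw : ∀ e, 0 < w e) (e : Sym2 (Fin n)) :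
    0 ≤ extWeight w e := by
  unfold extWeight
  split_ifs with h
  exacts [(hw _).le, le_rfl]

lemma walkWeight_eq {n : ℕ} (w : Edge n → ℝ) {u v : Fin n}
    (p : (⊤ : SimpleGraph (Fin n)).Walk u v) :
    walkWeight w p = (p.edges.map (extWeight w)).sum := by
  unfold walkWeight
  conv_rhs => rw [← List.attach_map_subtype_val p.edges, List.map_map]
  congr 1
  refine List.map_congr_left fun e _ => ?_
  exact (extWeight_of_mem w (p.edges_subset_edgeSet e.2)).symm

lemma walkWeight_nonneg {n : ℕ} {w : Edge n → ℝ} (hw : ∀ e, 0 < w e) {u v : Fin n}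
    (p : (⊤ : SimpleGraph (Fin n)).Walk u v) : 0 ≤ walkWeight w p := by
  rw [walkWeight_eq]
  refine List.sum_nonneg fun x hx => ?_
  obtain ⟨e, -, rfl⟩ := List.mem_map.1 hx
  exact extWeight_nonneg hw e

lemma walkWeight_reverse {n : ℕ} (w : Edge n → ℝ) {u v : Fin n}
    (p : (⊤ : SimpleGraph (Fin n)).Walk u v) : walkWeight w p.reverse = walkWeight w p := by
  rw [walkWeight_eq, walkWeight_eq, SimpleGraph.Walk.edges_reverse, List.map_reverse,
    List.sum_reverse]

lemma walkWeight_cons {n : ℕ} (w : Edge n → ℝ) {u v x : Fin n}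
    (h : (⊤ : SimpleGraph (Fin n)).Adj u x) (p : (⊤ : SimpleGraph (Fin n)).Walk x v) :
    walkWeight w (.cons h p) = w ⟨s(u, x), h⟩ + walkWeight w p := by
  rw [walkWeight_eq, walkWeight_eq, SimpleGraph.Walk.edges_cons, List.map_cons, List.sum_cons,
    extWeight_of_mem w (e := s(u, x)) h]

lemma dist_le_walkWeight {n : ℕ} (w : Edge n → ℝ) {u v : Fin n}
    (p : (⊤ : SimpleGraph (Fin n)).Path u v) : dist w u v ≤ walkWeight w p.1 :=
  ciInf_le (Set.finite_range _).bddBelow p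

lemma exists_path_dist_eq {n : ℕ} (w : Edge n → ℝ) (u v : Fin n) :
    ∃ p : (⊤ : SimpleGraph (Fin n)).Path u v, walkWeight w p.1 = dist w u v := by
  classical
  have : Nonempty ((⊤ : SimpleGraph (Fin n)).Path u v) := by
    by_cases h : u = v
    · subst h
      exact ⟨.nil⟩
    · exact ⟨.singleton (by simpa using h)⟩
  exact exists_eq_ciInf_of_finite

lemma dist_nonneg {n : ℕ} {w : Edge n → ℝ} (hw : ∀ e, 0 < w e) (u v : Fin n) :
    0 ≤ dist w u v := by
  obtain ⟨p, hp⟩ := exists_path_dist_eq w u v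
  rw [← hp]
  exact walkWeight_nonneg hw _

lemma dist_self_le {n : ℕ} (w : Edge n → ℝ) (u : Fin n) : dist w u u ≤ 0 :=
  (dist_le_walkWeight w .nil).trans (by simp [walkWeight_eq, SimpleGraph.Path.nil])

lemma dist_le_weight {n : ℕ} (w : Edge n → ℝ) {u v : Fin n}
    (h : (⊤ : SimpleGraph (Fin n)).Adj u v) : dist w u v ≤ w ⟨s(u, v), h⟩ := by
  classical
  refine (dist_le_walkWeight w (.singleton h)).trans_eq ?_
  simp [SimpleGraph.Path.singleton, walkWeight_eq]
  exact extWeight_of_mem w (e := s(u, v)) h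

/-! ### Bounding the connection cost below by distinct edges. -/

/-- The distance from a vertex to the nearest open facility. -/
noncomputable def distTo {n : ℕ} (w : Edge n → ℝ) (U : Finset (Fin n)) (v : Fin n) : ℝ :=
  ⨅ u : {u : Fin n // u ∈ U}, dist w u.1 v

lemma cost_eq {n : ℕ} (f : Fin n → ℝ) (w : Edge n → ℝ) (U : Finset (Fin n)) :
    cost f w U = ∑ u ∈ U, f u + ∑ v, distTo w U v := rfl

lemma distTo_le {n : ℕ} (w : Edge n → ℝ) {U : Finset (Fin n)} {u : Fin n} (hu : u ∈ U)
    (v : Fin n) : distTo w U v ≤ dist w u v :=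
  ciInf_le (f := fun u : {u : Fin n // u ∈ U} => dist w u.1 v) (Set.finite_range _).bddBelow ⟨u, hu⟩

lemma distTo_nonneg {n : ℕ} {w : Edge n → ℝ} (hw : ∀ e, 0 < w e) (U : Finset (Fin n))
    (v : Fin n) : 0 ≤ distTo w U v :=
  Real.iInf_nonneg fun u => dist_nonneg hw u.1 v

/-- The last edge of a shortest path from the open facilities to `v`. -/
lemma exists_last_edge {n : ℕ} {w : Edge n → ℝ} (hw : ∀ e, 0 < w e) {U : Finset (Fin n)}
    (hU : U.Nonempty) {v : Fin n} (hv : v ∉ U) :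
    ∃ (x : Fin n) (h : (⊤ : SimpleGraph (Fin n)).Adj v x),
      distTo w U x < distTo w U v ∧ w ⟨s(v, x), h⟩ ≤ distTo w U v := by
  have : Nonempty {u : Fin n // u ∈ U} := hU.to_subtype
  obtain ⟨⟨u, hu⟩, hmin⟩ :=
    exists_eq_ciInf_of_finite (f := fun u : {u : Fin n // u ∈ U} => dist w u.1 v)
  change dist w u v = distTo w U v at hmin
  obtain ⟨p, hp⟩ := exists_path_dist_eq w u v
  -- Reversing the path makes its last edge the head of the walk, so that case analysis exposes it.
  rw [← hmin, ← hp, ← walkWeight_reverse]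
  have hpath := p.2.reverse
  generalize p.1.reverse = r at hpath
  cases r with
  | nil => exact absurd hu hv
  | @cons _ x _ h q =>
    refine ⟨x, h, ?_, ?_⟩
    · rw [walkWeight_cons]
      have h1 := distTo_le w hu x
      have h2 := dist_le_walkWeight w ⟨q.reverse, ((SimpleGraph.Walk.cons_isPath_iff h q).1 hpath).1.reverse⟩
      rw [walkWeight_reverse] at h2
      linarith [hw ⟨s(v, x), h⟩]
    · rw [walkWeight_cons]
      linarith [walkWeight_nonneg hw q]

/-- The connection cost is at least the weight of a set of `n - |U|` edges. -/
lemma exists_edges_le {n : ℕ} {w : Edge n → ℝ} (hw : ∀ e, 0 < w e) {U : Finset (Fin n)}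
    (hU : U.Nonempty) :
    ∃ A : Finset (Edge n), A.card = n - U.card ∧ ∑ e ∈ A, w e ≤ ∑ v, distTo w U v := by
  classical
  choose! x h hlt hle using fun v (hv : v ∉ U) => exists_last_edge hw hU hv
  let g : {v // v ∈ Uᶜ} → Edge n := fun v =>
    ⟨s(v.1, x v.1), h v.1 (Finset.mem_compl.1 v.2)⟩
  have hg : Function.Injective g := by
    rintro ⟨a, ha⟩ ⟨b, hb⟩ hab
    have hab' : s(a, x a) = s(b, x b) := congrArg Subtype.val hab
    rw [Sym2.eq_iff] at hab'
    rcases hab' with ⟨h1, -⟩ | ⟨h1, h2⟩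
    · exact Subtype.ext h1
    -- Here `x a = b` and `x b = a`, so each of `a`, `b` would be strictly closer to `U` than the
    -- other.
    · have h3 := hlt a (Finset.mem_compl.1 ha)
      have h4 := hlt b (Finset.mem_compl.1 hb)
      rw [h2] at h3
      rw [← h1] at h4
      exact absurd h3 h4.not_gt
  refine ⟨Finset.univ.map ⟨g, hg⟩, ?_, ?_⟩
  · simp [Finset.card_compl]
  · rw [Finset.sum_map]
    calc ∑ v : {v // v ∈ Uᶜ}, w (g v) ≤ ∑ v : {v // v ∈ Uᶜ}, distTo w U v.1 :=
          Finset.sum_le_sum fun v _ => hle v.1 (Finset.mem_compl.1 v.2)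
      _ = ∑ v ∈ Uᶜ, distTo w U v := Finset.sum_coe_sort Uᶜ (fun v => distTo w U v)
      _ ≤ _ := Finset.sum_le_sum_of_subset_of_nonneg (Finset.subset_univ _)
          fun v _ _ => distTo_nonneg hw U v

/-! ### Sums of opening costs and the deterministic lower bound on `OPT`. -/

lemma card_filter_val_lt {n m : ℕ} (h : m ≤ n) :
    (Finset.univ.filter fun j : Fin n => j.val < m).card = m := by
  simp [Fin.card_filter_val_lt, h]

/-- Any `m` opening costs sum to at least the sum of the `m` smallest ones. -/
lemma F_card_le_sum {n : ℕ} {f : Fin n → ℝ} (hf : Monotone f) (U : Finset (Fin n)) :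
    F f U.card ≤ ∑ u ∈ U, f u := by
  classical
  have hm : U.card ≤ n := by simpa using U.card_le_univ
  set m := U.card with hmdef
  set A := Finset.univ.filter fun j : Fin n => j.val < m with hA
  have hc : (A \ U).card = (U \ A).card := by
    rw [Finset.card_sdiff_comm]
    rw [card_filter_val_lt hm]
  unfold F
  rw [← hA, ← Finset.sum_inter_add_sum_sdiff A U, ← Finset.sum_inter_add_sum_sdiff U A,
    Finset.inter_comm U A]
  gcongr 1
  -- Exchange argument: the two differences have equal size, and `f ⟨m, _⟩` separates the costs in
  -- one from those in the other.
  rcases (U \ A).eq_empty_or_nonempty with he | hne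
  · have : A \ U = ∅ := by rw [← Finset.card_eq_zero, hc, he, Finset.card_empty]
    rw [he, this]
  · have hb : m < n := by
      obtain ⟨b, hb⟩ := hne
      have := (Finset.mem_sdiff.1 hb).2
      simp [hA] at this
      exact this.trans_lt b.2
    calc ∑ x ∈ A \ U, f x ≤ (A \ U).card • f ⟨m, hb⟩ := by
          refine Finset.sum_le_card_nsmul _ _ _ fun x hx => hf ?_
          have := (Finset.mem_sdiff.1 hx).1
          simp [hA] at this
          exact Fin.mk_le_mk.2 this.le
      _ = (U \ A).card • f ⟨m, hb⟩ := by rw [hc]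
      _ ≤ _ := by
          refine Finset.card_nsmul_le_sum _ _ _ fun x hx => hf ?_
          have := (Finset.mem_sdiff.1 hx).2
          simp [hA] at this
          exact Fin.mk_le_mk.2 this

lemma F_pos {n : ℕ} {f : Fin n → ℝ} (hf : ∀ i, 0 < f i) {m : ℕ} (hm : 0 < m) (hn : 0 < n) :
    0 < F f m :=
  Finset.sum_pos (fun i _ => hf i) ⟨⟨0, hn⟩, by simp [hm]⟩

lemma F_self {n : ℕ} (f : Fin n → ℝ) : F f n = ∑ j, f j := by
  simp [F]

lemma F_mono {n : ℕ} {f : Fin n → ℝ} (hf : ∀ i, 0 < f i) {a b : ℕ} (h : a ≤ b) :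
    F f a ≤ F f b := by
  refine Finset.sum_le_sum_of_subset_of_nonneg (fun x hx => ?_) fun i _ _ => (hf i).le
  simp only [Finset.mem_filter, Finset.mem_univ, true_and] at hx ⊢
  omega

lemma exists_cost_eq_OPT {n : ℕ} (hn : 0 < n) (f : Fin n → ℝ) (w : Edge n → ℝ) :
    ∃ U : Finset (Fin n), U.Nonempty ∧ cost f w U = OPT f w := by
  have : Nonempty {U : Finset (Fin n) // U.Nonempty} := ⟨⟨{⟨0, hn⟩}, by simp⟩⟩
  obtain ⟨U, hU⟩ := exists_eq_ciInf_of_finite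
    (f := fun U : {U : Finset (Fin n) // U.Nonempty} => cost f w U.1)
  exact ⟨U.1, U.2, hU⟩

lemma exists_edges_le_OPT {n : ℕ} (hn : 0 < n) {f : Fin n → ℝ} (hf : Monotone f)
    {w : Edge n → ℝ} (hw : ∀ e, 0 < w e) :
    ∃ A : Finset (Edge n), A.card ≤ n - 1 ∧ F f (n - A.card) + ∑ e ∈ A, w e ≤ OPT f w := by
  obtain ⟨U, hU, hcost⟩ := exists_cost_eq_OPT hn f w
  obtain ⟨A, hA, hle⟩ := exists_edges_le hw hU
  have h1 : 0 < U.card := hU.card_pos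
  have h2 : U.card ≤ n := by simpa using U.card_le_univ
  refine ⟨A, by omega, ?_⟩
  rw [← hcost, cost_eq, hA, show n - (n - U.card) = U.card by omega]
  exact add_le_add (F_card_le_sum hf U) hle

/-! ### Exponential weights: sums and minima. -/

instance isProbabilityMeasure_expMeasure_one : IsProbabilityMeasure (expMeasure 1) :=
  isProbabilityMeasure_expMeasure one_pos

instance isProbabilityMeasure_weightLaw (n : ℕ) : IsProbabilityMeasure (weightLaw n) := by
  unfold weightLaw
  infer_instance

lemma expMeasure_Ioi {s : ℝ} (hs : 0 ≤ s) :
    expMeasure 1 (Set.Ioi s) = ENNReal.ofReal (Real.exp (-s)) := by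
  have h := cdf_expMeasure_eq (r := 1) one_pos s
  rw [cdf_eq_real, if_pos hs] at h
  have h2 : (expMeasure 1).real (Set.Ioi s) = Real.exp (-s) := by
    rw [← Set.compl_Iic, probReal_compl_eq_one_sub measurableSet_Iic, h]
    simp
  rw [← h2, ofReal_measureReal]

lemma ae_weight_pos (n : ℕ) : ∀ᵐ w ∂(weightLaw n), ∀ e, 0 < w e := by
  rw [ae_all_iff]
  intro e
  have h1 : ∀ᵐ x ∂(expMeasure 1), 0 < x := by
    have h := expMeasure_Ioi le_rfl
    rw [neg_zero, Real.exp_zero, ENNReal.ofReal_one] at h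
    exact (prob_compl_eq_zero_iff measurableSet_Ioi).2 h
  exact (measurePreserving_eval (fun _ : Edge n => expMeasure 1) e).quasiMeasurePreserving.ae h1

lemma lintegral_expMeasure_le (g : ℝ → ENNReal) (hg : Measurable g) :
    ∫⁻ x, g x ∂(expMeasure 1) ≤ ∫⁻ x in Set.Ioi 0, g x := by
  have : ∀ᵐ x ∂(expMeasure 1), x ∈ Set.Ioi (0 : ℝ) := by
    have h := expMeasure_Ioi le_rfl
    rw [neg_zero, Real.exp_zero, ENNReal.ofReal_one] at h
    exact (prob_compl_eq_zero_iff measurableSet_Ioi).2 h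
  rw [← Measure.restrict_eq_self_of_ae_mem this]
  have h2 : expMeasure 1 = volume.withDensity (exponentialPDF 1) := rfl
  have hm : Measurable (exponentialPDF 1) :=
    (measurable_exponentialPDFReal 1).ennreal_ofReal
  rw [h2, restrict_withDensity measurableSet_Ioi, lintegral_withDensity_eq_lintegral_mul _ hm hg]
  refine setLIntegral_mono hg fun x hx => ?_
  rw [Pi.mul_apply, exponentialPDF_of_nonneg (le_of_lt hx)]
  refine mul_le_of_le_one_left' ?_
  rw [ENNReal.ofReal_le_one, one_mul, one_mul, Real.exp_le_one_iff]
  exact neg_nonpos.2 (le_of_lt hx)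

/-- Convolution of `x^k/k!` with the constant density `1` on the half-line: substitute `s = x + y`,
swap the integrals over `0 < y < s`, and integrate `(s - y)^k/k!` in `y`. -/
lemma lintegral_Ioi_shift (g : ℝ → ENNReal) (hg : Measurable g) (k : ℕ) :
    ∫⁻ y in Set.Ioi (0 : ℝ), ∫⁻ x in Set.Ioi (0 : ℝ),
        g (x + y) * ENNReal.ofReal (x ^ k / k.factorial) =
      ∫⁻ s in Set.Ioi (0 : ℝ), g s * ENNReal.ofReal (s ^ (k + 1) / (k + 1).factorial) := by
  have hp : Measurable fun x : ℝ => ENNReal.ofReal (x ^ k / k.factorial) := by fun_prop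
  have h1 : ∀ y : ℝ, ∫⁻ x in Set.Ioi (0 : ℝ), g (x + y) * ENNReal.ofReal (x ^ k / k.factorial) =
      ∫⁻ s, (Set.Ioi y).indicator
        (fun s => g s * ENNReal.ofReal ((s - y) ^ k / k.factorial)) s := by
    intro y
    rw [← lintegral_add_right_eq_self (μ := volume) ((Set.Ioi y).indicator _) y,
      ← lintegral_indicator measurableSet_Ioi]
    refine lintegral_congr fun x => ?_
    simp only [Set.indicator, Set.mem_Ioi, lt_add_iff_pos_left, add_sub_cancel_right]
  simp_rw [h1]
  rw [← lintegral_indicator measurableSet_Ioi, ← lintegral_indicator measurableSet_Ioi]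
  have h2 : ∀ y : ℝ, (Set.Ioi (0 : ℝ)).indicator (fun y => ∫⁻ s, (Set.Ioi y).indicator
        (fun s => g s * ENNReal.ofReal ((s - y) ^ k / k.factorial)) s) y =
      ∫⁻ s, g s * {p : ℝ × ℝ | 0 < p.1 ∧ p.1 < p.2}.indicator
        (fun p => ENNReal.ofReal ((p.2 - p.1) ^ k / k.factorial)) (y, s) := by
    intro y
    by_cases hy : 0 < y
    · rw [Set.indicator_of_mem (by exact hy)]
      refine lintegral_congr fun s => ?_
      by_cases hs : y < s <;> simp [Set.indicator, hy, hs]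
    · rw [Set.indicator_of_notMem (by exact hy)]
      simp [Set.indicator, hy]
  simp_rw [h2]
  have hS : MeasurableSet {p : ℝ × ℝ | 0 < p.1 ∧ p.1 < p.2} :=
    (measurableSet_lt measurable_const measurable_fst).inter
      (measurableSet_lt measurable_fst measurable_snd)
  have hK : Measurable ({p : ℝ × ℝ | 0 < p.1 ∧ p.1 < p.2}.indicator
        (fun p => ENNReal.ofReal ((p.2 - p.1) ^ k / k.factorial))) :=
    Measurable.indicator (by fun_prop) hS
  rw [lintegral_lintegral_swap (((hg.comp measurable_snd).mul hK).aemeasurable)]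
  refine lintegral_congr fun s => ?_
  have hKs : Measurable fun y : ℝ => {p : ℝ × ℝ | 0 < p.1 ∧ p.1 < p.2}.indicator
        (fun p => ENNReal.ofReal ((p.2 - p.1) ^ k / k.factorial)) (y, s) :=
    hK.comp (by fun_prop : Measurable fun y : ℝ => (y, s))
  rw [lintegral_const_mul _ hKs]
  by_cases hs : 0 < s
  · rw [Set.indicator_of_mem (by exact hs)]
    congr 1
    have h3 : ∀ y : ℝ, {p : ℝ × ℝ | 0 < p.1 ∧ p.1 < p.2}.indicator
        (fun p => ENNReal.ofReal ((p.2 - p.1) ^ k / k.factorial)) (y, s) =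
        (Set.Ioo 0 s).indicator (fun y => ENNReal.ofReal ((s - y) ^ k / k.factorial)) y :=
      fun y => rfl
    simp_rw [h3]
    rw [lintegral_indicator measurableSet_Ioo, restrict_Ioo_eq_restrict_Ioc,
      ← ofReal_integral_eq_lintegral_ofReal]
    · congr 1
      rw [← intervalIntegral.integral_of_le hs.le, intervalIntegral.integral_div,
        intervalIntegral.integral_comp_sub_left (fun x => x ^ k) s]
      simp [Nat.factorial_succ]
      field_simp
    · exact (Continuous.integrableOn_Icc (by fun_prop)).mono_set Set.Ioc_subset_Icc_self
    · refine (ae_restrict_iff' measurableSet_Ioc).2 (Filter.Eventually.of_forall fun y hy => ?_)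
      have : 0 ≤ s - y := sub_nonneg.2 hy.2
      positivity
  · rw [Set.indicator_of_notMem (by exact hs)]
    have h3 : ∀ y : ℝ, {p : ℝ × ℝ | 0 < p.1 ∧ p.1 < p.2}.indicator
        (fun p => ENNReal.ofReal ((p.2 - p.1) ^ k / k.factorial)) (y, s) = 0 := fun y => by
      refine Set.indicator_of_notMem ?_ _
      rintro ⟨h, h'⟩
      exact hs (h.trans h')
    simp [h3]

/-- The law of the sum of `k + 1` edge weights is dominated by the density `s ^ k / k!`. -/
lemma lintegral_comp_sum_weight_le {n : ℕ} (A : Finset (Edge n)) :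
    ∀ k : ℕ, A.card = k + 1 → ∀ g : ℝ → ENNReal, Measurable g →
    ∫⁻ w, g (∑ e ∈ A, w e) ∂(weightLaw n) ≤
      ∫⁻ s in Set.Ioi (0 : ℝ), g s * ENNReal.ofReal (s ^ k / k.factorial) := by
  classical
  have hind : iIndepFun (fun (e : Edge n) (w : Edge n → ℝ) => w e) (weightLaw n) :=
    iIndepFun_pi (X := fun _ x => x) fun _ => aemeasurable_id
  induction A using Finset.induction_on with
  | empty => simp
  | insert e A he ih =>
    intro k hk g hg
    rw [Finset.card_insert_of_notMem he] at hk
    have hmap : (weightLaw n).map (fun w => w e) = expMeasure 1 :=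
      (measurePreserving_eval (fun _ : Edge n => expMeasure 1) e).map_eq
    rcases k with _ | k
    · have : A = ∅ := Finset.card_eq_zero.1 (by omega)
      subst this
      simp only [insert_empty_eq, Finset.sum_singleton, pow_zero, Nat.factorial_zero, Nat.cast_one,
        div_one, ENNReal.ofReal_one, mul_one]
      rw [← lintegral_map (f := g) (g := fun w : Edge n → ℝ => w e) hg (by fun_prop), hmap]
      exact lintegral_expMeasure_le g hg
    · have hA : A.card = k + 1 := by omega
      have hS : Measurable fun w : Edge n → ℝ => ∑ e ∈ A, w e := by fun_prop
      have hI : IndepFun (fun w : Edge n → ℝ => ∑ e ∈ A, w e) (fun w => w e) (weightLaw n) := by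
        have := hind.indepFun_finsetSum_of_notMem (fun e => by fun_prop) he
        convert this using 1
        ext w
        simp
      have hprod := (indepFun_iff_map_prod_eq_prod_map_map hS.aemeasurable
        (measurable_pi_apply e).aemeasurable).1 hI
      calc ∫⁻ w, g (∑ e ∈ insert e A, w e) ∂(weightLaw n)
          = ∫⁻ w, (fun z : ℝ × ℝ => g (z.1 + z.2)) (∑ e ∈ A, w e, w e) ∂(weightLaw n) := by
            simp [Finset.sum_insert he, add_comm]
        _ = ∫⁻ y, ∫⁻ w, g (∑ e ∈ A, w e + y) ∂(weightLaw n) ∂(expMeasure 1) := by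
            rw [← lintegral_map (f := fun z : ℝ × ℝ => g (z.1 + z.2)) (by fun_prop) (by fun_prop),
              hprod, hmap, lintegral_prod_symm' _ (by fun_prop)]
            refine lintegral_congr fun y => ?_
            rw [lintegral_map (by fun_prop) hS]
        _ ≤ ∫⁻ y, (∫⁻ x in Set.Ioi (0 : ℝ), g (x + y) * ENNReal.ofReal (x ^ k / k.factorial))
              ∂(expMeasure 1) := by
            refine lintegral_mono fun y => ?_
            exact ih k hA (fun x => g (x + y)) (by fun_prop)
        _ ≤ _ := by
            rw [← lintegral_Ioi_shift g hg k]
            refine lintegral_expMeasure_le _ ?_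
            refine Measurable.lintegral_prod_left' (f := fun z : ℝ × ℝ =>
              g (z.1 + z.2) * ENNReal.ofReal (z.1 ^ k / k.factorial)) ?_
            fun_prop

/-- The second moment of the minimum weight of `m` distinct edges. -/
lemma lintegral_sq_min_weight_le {n : ℕ} {ι : Type*} [Fintype ι] [Nonempty ι] (j : ι → Edge n)
    (hj : Function.Injective j) :
    ∫⁻ w, ENNReal.ofReal ((⨅ i, w (j i)) ^ 2) ∂(weightLaw n) ≤
      ENNReal.ofReal (2 / (Fintype.card ι : ℝ) ^ 2) := by
  classical
  have hmeas : Measurable fun w : Edge n → ℝ => ⨅ i, w (j i) :=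
    Measurable.iInf fun i => by fun_prop
  have hnn : 0 ≤ᵐ[weightLaw n] fun w => ⨅ i, w (j i) := by
    filter_upwards [ae_weight_pos n] with w hw
    exact Real.iInf_nonneg fun i => (hw _).le
  have hcard : (0 : ℝ) < Fintype.card ι := by exact_mod_cast Fintype.card_pos
  set m : ℝ := ((Fintype.card ι : ℕ) : ℝ) with hm
  -- Layer-cake formula; the minimum of `m` independent weights has tail `exp(-m t)`.
  have h := lintegral_rpow_eq_lintegral_meas_lt_mul (weightLaw n) hnn hmeas.aemeasurable
    (p := 2) two_pos
  simp only [Real.rpow_two] at h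
  rw [h]
  have htail : ∀ t ∈ Set.Ioi (0 : ℝ), weightLaw n {w | t < ⨅ i, w (j i)} *
      ENNReal.ofReal (t ^ ((2 : ℝ) - 1)) =
      ENNReal.ofReal (t ^ ((2 : ℝ) - 1) * Real.exp (-(m * t))) := by
    intro t ht
    have hset : {w : Edge n → ℝ | t < ⨅ i, w (j i)} =
        Set.univ.pi fun e => if e ∈ Set.range j then Set.Ioi t else Set.univ := by
      ext w
      simp only [Set.mem_ofPred_eq, Set.mem_univ_pi]
      constructor
      · intro hlt e
        split_ifs with he
        · obtain ⟨i, rfl⟩ := he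
          exact hlt.trans_le (ciInf_le (Set.finite_range _).bddBelow i)
        · trivial
      · intro hall
        obtain ⟨i, hi⟩ := exists_eq_ciInf_of_finite (f := fun i => w (j i))
        rw [← hi]
        simpa using hall (j i)
    have hprod : weightLaw n {w | t < ⨅ i, w (j i)} = ENNReal.ofReal (Real.exp (-(m * t))) := by
      rw [hset, weightLaw, Measure.pi_pi]
      have : ∀ e : Edge n, expMeasure 1 (if e ∈ Set.range j then Set.Ioi t else Set.univ) =
          if e ∈ Finset.univ.map ⟨j, hj⟩ then ENNReal.ofReal (Real.exp (-t)) else 1 := by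
        intro e
        by_cases he : e ∈ Set.range j
        · rw [if_pos he, if_pos (by simpa using he), expMeasure_Ioi (le_of_lt ht)]
        · rw [if_neg he, if_neg (by simpa using he), measure_univ]
      simp_rw [this]
      rw [Finset.prod_ite_mem, Finset.univ_inter, Finset.prod_const, Finset.card_map,
        Finset.card_univ, ← ENNReal.ofReal_pow (Real.exp_pos _).le, ← Real.exp_nat_mul, mul_neg]
    rw [hprod, ← ENNReal.ofReal_mul (Real.exp_pos _).le, mul_comm]
  rw [setLIntegral_congr_fun measurableSet_Ioi htail]
  have hint := Real.integral_rpow_mul_exp_neg_mul_Ioi (a := 2) two_pos hcard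
  have hval : ∫ t in Set.Ioi (0 : ℝ), t ^ ((2 : ℝ) - 1) * Real.exp (-(m * t)) = 1 / m ^ 2 := by
    rw [hint, Real.Gamma_two, Real.rpow_two]
    simp
  rw [← ofReal_integral_eq_lintegral_ofReal, hval, ← ENNReal.ofReal_mul two_pos.le]
  · exact ENNReal.ofReal_le_ofReal (by rw [mul_one_div])
  -- A non-integrable function would have Bochner integral `0`, contradicting the positive value
  -- `1/m²`.
  · by_contra hni
    rw [integral_undef hni] at hval
    have : 0 < 1 / m ^ 2 := by positivity
    linarith
  · refine (ae_restrict_iff' measurableSet_Ioi).2 (Filter.Eventually.of_forall fun t ht => ?_)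
    have : (0 : ℝ) < t := ht
    positivity

/-! ### The regimes in which the maximum controls the bound. -/

lemma maxTerm_nonneg {n : ℕ} {f : Fin n → ℝ} (hf : ∀ i, 0 < f i) (k : ℕ) : 0 ≤ maxTerm f k := by
  have : 0 ≤ F f (n - k) := Finset.sum_nonneg fun i _ => (hf i).le
  unfold maxTerm
  positivity

/-- When `k² ≤ n² F_{n-k}`, the first summand of the denominator of `maxTerm` is the larger one,
which costs a factor `2`. -/
lemma inv_F_sq_le_maxTerm {n : ℕ} {f : Fin n → ℝ} (hf : ∀ i, 0 < f i) {k : ℕ} (hk : k < n)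
    (h : (k : ℝ) ^ 2 ≤ n ^ 2 * F f (n - k)) : 1 / F f (n - k) ^ 2 ≤ 2 * maxTerm f k := by
  have hn : (0 : ℝ) < n := by exact_mod_cast (by omega : 0 < n)
  have hF : 0 < F f (n - k) := F_pos hf (by omega) (by omega)
  unfold maxTerm
  set x := F f (n - k)
  rw [← mul_div_assoc, div_le_div_iff₀ (by positivity) (by positivity)]
  have h2 : (k : ℝ) ^ 4 ≤ n ^ 4 * x ^ 2 := by
    calc (k : ℝ) ^ 4 = (k ^ 2) ^ 2 := by ring
      _ ≤ (n ^ 2 * x) ^ 2 := by gcongr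
      _ = _ := by ring
  have h3 := mul_le_mul_of_nonneg_right h2 hF.le
  have h4 : 0 ≤ (k : ℝ) * n ^ 2 * x ^ 2 := by positivity
  nlinarith

/-- Below this value, the sum of `k` edge weights is exceptionally small. -/
noncomputable def thresh (n k : ℕ) : ℝ := (k : ℝ) ^ 2 / (18 * n ^ 2)

/-- In the opposite regime the second summand dominates; `648 = 2 * 18²`, with `18` from `thresh`.
-/
lemma inv_thresh_sq_le_maxTerm {n : ℕ} {f : Fin n → ℝ} (hf : ∀ i, 0 < f i) {k : ℕ} (hk : k < n)
    (hk0 : 0 < k) (h : n ^ 2 * F f (n - k) < (k : ℝ) ^ 2) :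
    1 / thresh n k ^ 2 ≤ 648 * maxTerm f k := by
  have hn : (0 : ℝ) < n := by exact_mod_cast (by omega : 0 < n)
  have hk' : (0 : ℝ) < k := by exact_mod_cast hk0
  have hF : 0 < F f (n - k) := F_pos hf (by omega) (by omega)
  unfold maxTerm thresh
  set x := F f (n - k)
  have h2 : (n : ℝ) ^ 4 * x ^ 2 ≤ (k : ℝ) ^ 4 := by
    calc (n : ℝ) ^ 4 * x ^ 2 = (n ^ 2 * x) ^ 2 := by ring
      _ ≤ ((k : ℝ) ^ 2) ^ 2 := by gcongr
      _ = _ := by ring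
  have h3 : (n : ℝ) ^ 4 * x ^ 3 + k ^ 4 * x ≤ 2 * k ^ 4 * x := by nlinarith
  calc 1 / ((k : ℝ) ^ 2 / (18 * n ^ 2)) ^ 2 = 648 * (n ^ 4 * x / (2 * k ^ 4 * x)) := by
        field_simp
        norm_num
    _ ≤ 648 * ((n ^ 4 * x + k * n ^ 2) / (n ^ 4 * x ^ 3 + k ^ 4 * x)) := by
        gcongr
        have : 0 ≤ (k : ℝ) * n ^ 2 := by positivity
        linarith

/-- Lets a constant factor on the entry `1/F_n²` be absorbed. If `n² F_{n-1} < 1`, the `k = 1` term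
is itself at least `n²/2`, while `1/F_n² ≤ n²`. -/
lemma inv_F_sq_le_maxTerm_one {n : ℕ} {f : Fin n → ℝ} (hf : ∀ i, 0 < f i) (hn : 2 ≤ n)
    (h : 1 / (n : ℝ) ≤ F f n) : 1 / F f n ^ 2 ≤ 2 * maxTerm f 1 := by
  have hn' : (2 : ℝ) ≤ n := by exact_mod_cast hn
  have hF : 0 < F f (n - 1) := F_pos hf (by omega) (by omega)
  by_cases hs : ((1 : ℕ) : ℝ) ^ 2 ≤ n ^ 2 * F f (n - 1)
  · refine le_trans ?_ (inv_F_sq_le_maxTerm hf (by omega) hs)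
    gcongr
    exact F_mono hf (by omega)
  · have h1 : 1 / F f n ^ 2 ≤ n ^ 2 := by
      rw [div_le_iff₀ (by have : 0 < 1 / (n : ℝ) := by positivity
                          have := this.trans_le h
                          positivity)]
      have h2 : 1 ≤ F f n * n := (div_le_iff₀ (by positivity)).1 h
      nlinarith
    refine h1.trans ?_
    push Not at hs
    norm_num at hs
    unfold maxTerm
    set x := F f (n - 1)
    rw [← mul_div_assoc, le_div_iff₀ (by positivity)]
    have h2 : (n : ℝ) ^ 2 * x ^ 2 ≤ x := by nlinarith
    have h3 : (n : ℝ) ^ 4 * x ^ 3 ≤ x := by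
      calc (n : ℝ) ^ 4 * x ^ 3 = (n ^ 2 * x) * (n ^ 2 * x) * x := by ring
        _ ≤ 1 * 1 * x := by gcongr
        _ = x := by ring
    have h4 : x ≤ 1 := by nlinarith
    push_cast
    nlinarith [pow_pos (show (0 : ℝ) < n by linarith) 2, pow_pos (show (0 : ℝ) < n by linarith) 4,
      mul_pos (pow_pos (show (0 : ℝ) < n by linarith) 4) hF]

lemma lintegral_Ioi_inv_sq {a : ℝ} (ha : 0 < a) :
    ∫⁻ s in Set.Ioi (0 : ℝ), ENNReal.ofReal (1 / (a + s) ^ 2) = ENNReal.ofReal (1 / a) := by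
  have hd : ∀ s ∈ Set.Ici (0 : ℝ), HasDerivAt (fun s => -(a + s)⁻¹) (1 / (a + s) ^ 2) s := by
    intro s hs
    have hs' : (0 : ℝ) ≤ s := hs
    have := (((hasDerivAt_id s).const_add a).inv (by simp; positivity)).neg
    exact this.congr_deriv (by simp [neg_div])
  have hl : Filter.Tendsto (fun s : ℝ => -(a + s)⁻¹) Filter.atTop (nhds 0) := by
    simpa using (tendsto_inv_atTop_zero.comp
      (Filter.tendsto_atTop_add_const_left _ a Filter.tendsto_id)).neg
  have hpos : ∀ s ∈ Set.Ioi (0 : ℝ), 0 ≤ 1 / (a + s) ^ 2 := fun s _ => by positivity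
  rw [← ofReal_integral_eq_lintegral_ofReal (integrableOn_Ioi_deriv_of_nonneg' hd hpos hl)
    ((ae_restrict_iff' measurableSet_Ioi).2 (Filter.Eventually.of_forall hpos)),
    integral_Ioi_of_hasDerivAt_of_nonneg' hd hpos hl]
  simp

/-! ### Expected contribution of exceptionally light edge sets. -/

/-- The fourth power of `1 / (F_{n-k} + ∑ e ∈ A, w e)`, cut off where it is under control, with
`k = |A|`. -/
noncomputable def excess {n : ℕ} (f : Fin n → ℝ) (k : ℕ) (A : Finset (Edge n)) (w : Edge n → ℝ) :
    ℝ :=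
  open Classical in
  if n ^ 2 * F f (n - k) < (k : ℝ) ^ 2 ∧ ∑ e ∈ A, w e < thresh n k then
    1 / (F f (n - k) + ∑ e ∈ A, w e) ^ 4
  else 0

lemma excess_nonneg {n : ℕ} (f : Fin n → ℝ) (k : ℕ) (A : Finset (Edge n)) (w : Edge n → ℝ) :
    0 ≤ excess f k A w := by
  unfold excess
  split_ifs <;> positivity

lemma measurable_excess {n : ℕ} (f : Fin n → ℝ) (k : ℕ) (A : Finset (Edge n)) :
    Measurable (excess f k A) := by
  unfold excess
  refine Measurable.ite ?_ (by fun_prop) measurable_const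
  by_cases h : n ^ 2 * F f (n - k) < (k : ℝ) ^ 2
  · simp only [h, true_and]
    exact measurableSet_lt (by fun_prop) measurable_const
  · simp [h]

/-- Two of the four powers of `F + s` absorb the density `s^j/j!`; the other two integrate to `1/F`.
-/
lemma lintegral_excess_le {n : ℕ} {f : Fin n → ℝ} {j : ℕ}
    {A : Finset (Edge n)} (hA : A.card = j + 1) (hF : 0 < F f (n - (j + 1))) {c : ℝ} (hc : 0 ≤ c)
    (h : ∀ s, 0 < s → s < thresh n (j + 1) →
      s ^ j / j.factorial ≤ c * (F f (n - (j + 1)) + s) ^ 2) :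
    ∫⁻ w, ENNReal.ofReal (excess f (j + 1) A w) ∂(weightLaw n) ≤
      ENNReal.ofReal (c / F f (n - (j + 1))) := by
  classical
  set x := F f (n - (j + 1))
  let g : ℝ → ENNReal := fun s =>
    (Set.Iio (thresh n (j + 1))).indicator (fun s => ENNReal.ofReal (1 / (x + s) ^ 4)) s
  have hg : Measurable g := Measurable.indicator (by fun_prop) measurableSet_Iio
  calc ∫⁻ w, ENNReal.ofReal (excess f (j + 1) A w) ∂(weightLaw n)
      ≤ ∫⁻ w, g (∑ e ∈ A, w e) ∂(weightLaw n) := by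
        refine lintegral_mono fun w => ?_
        unfold excess
        split_ifs with hs
        · simp only [g]
          rw [Set.indicator_of_mem (by exact hs.2)]
        · simp
    _ ≤ ∫⁻ s in Set.Ioi (0 : ℝ), g s * ENNReal.ofReal (s ^ j / j.factorial) :=
        lintegral_comp_sum_weight_le A j hA g hg
    _ ≤ ∫⁻ s in Set.Ioi (0 : ℝ), ENNReal.ofReal c * ENNReal.ofReal (1 / (x + s) ^ 2) := by
        refine setLIntegral_mono (by fun_prop) fun s hs => ?_
        have hs0 : 0 < s := hs
        by_cases hst : s < thresh n (j + 1)
        · simp only [g]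
          rw [Set.indicator_of_mem (by exact hst), ← ENNReal.ofReal_mul (by positivity),
            ← ENNReal.ofReal_mul hc]
          refine ENNReal.ofReal_le_ofReal ?_
          calc 1 / (x + s) ^ 4 * (s ^ j / j.factorial)
              ≤ 1 / (x + s) ^ 4 * (c * (x + s) ^ 2) := by gcongr; exact h s hs0 hst
            _ = _ := by field_simp
        · simp only [g]
          rw [Set.indicator_of_notMem (by exact hst), zero_mul]
          exact zero_le
    _ = _ := by
        rw [lintegral_const_mul _ (by fun_prop), lintegral_Ioi_inv_sq hF,
          ← ENNReal.ofReal_mul hc, mul_one_div]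

lemma card_edge_le (n : ℕ) : Fintype.card (Edge n) ≤ n ^ 2 := by
  classical
  calc Fintype.card (Edge n) ≤ Fintype.card (Sym2 (Fin n)) :=
        Fintype.card_le_of_injective _ Subtype.val_injective
    _ ≤ Fintype.card (Fin n × Fin n) := Fintype.card_le_of_surjective _ Sym2.mk_surjective
    _ = n ^ 2 := by simp [sq]

lemma card_powersetCard_edge_le (n k : ℕ) :
    ((Finset.powersetCard k (Finset.univ : Finset (Edge n))).card : ℝ) ≤
      (n : ℝ) ^ (2 * k) / k.factorial := by
  rw [Finset.card_powersetCard, Finset.card_univ]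
  refine (Nat.choose_le_pow_div k _).trans ?_
  have : (Fintype.card (Edge n) : ℝ) ≤ n ^ 2 := by exact_mod_cast card_edge_le n
  rw [pow_mul]
  gcongr

lemma lintegral_sum_excess_le {n : ℕ} {f : Fin n → ℝ} {k : ℕ} {c : ℝ} (hc : 0 ≤ c)
    (h : ∀ A : Finset (Edge n), A.card = k →
      ∫⁻ w, ENNReal.ofReal (excess f k A w) ∂(weightLaw n) ≤ ENNReal.ofReal c) :
    ∫⁻ w, ENNReal.ofReal (∑ A ∈ Finset.powersetCard k Finset.univ, excess f k A w) ∂(weightLaw n) ≤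
      ENNReal.ofReal ((n : ℝ) ^ (2 * k) / k.factorial * c) := by
  simp_rw [ENNReal.ofReal_sum_of_nonneg fun A _ => excess_nonneg f k A _]
  rw [lintegral_finsetSum _ fun A _ => (measurable_excess f k A).ennreal_ofReal]
  calc _ ≤ ∑ A ∈ Finset.powersetCard k (Finset.univ : Finset (Edge n)), ENNReal.ofReal c :=
        Finset.sum_le_sum fun A hA => h A (Finset.mem_powersetCard.1 hA).2
    _ = ENNReal.ofReal ((Finset.powersetCard k (Finset.univ : Finset (Edge n))).card * c) := by
        rw [Finset.sum_const, nsmul_eq_mul, ENNReal.ofReal_mul (by positivity),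
          ENNReal.ofReal_natCast]
    _ ≤ _ := ENNReal.ofReal_le_ofReal
        (mul_le_mul_of_nonneg_right (card_powersetCard_edge_le n k) hc)

lemma lintegral_sum_excess_eq_zero {n : ℕ} {f : Fin n → ℝ} {k : ℕ}
    (h : ¬ n ^ 2 * F f (n - k) < (k : ℝ) ^ 2) :
    ∫⁻ w, ENNReal.ofReal (∑ A ∈ Finset.powersetCard k Finset.univ, excess f k A w)
      ∂(weightLaw n) = 0 := by
  simp [excess, h]

lemma lintegral_sum_excess_one_le {n : ℕ} (hn : 3 ≤ n) {f : Fin n → ℝ} (hf : ∀ i, 0 < f i) :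
    ∫⁻ w, ENNReal.ofReal (∑ A ∈ Finset.powersetCard 1 Finset.univ, excess f 1 A w) ∂(weightLaw n) ≤
      ENNReal.ofReal (13122 * (((n : ℝ) ^ 6 * F f (n - 1) ^ 2 + (n : ℝ) ^ 2) /
      ((n : ℝ) ^ 8 * F f (n - 1) ^ 7 + F f (n - 1) ^ 3))) := by
  by_cases h : n ^ 2 * F f (n - 1) < ((1 : ℕ) : ℝ) ^ 2
  swap
  · rw [lintegral_sum_excess_eq_zero h]
    exact zero_le
  have hn' : (3 : ℝ) ≤ n := by exact_mod_cast hn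
  have hF : 0 < F f (n - 1) := F_pos hf (by omega) (by omega)
  have key := lintegral_sum_excess_le (f := f) (k := 1)
    (c := 1 / F f (n - 1) ^ 2 / F f (n - 1)) (by positivity) fun A hA =>
    lintegral_excess_le (j := 0) hA hF (by positivity) fun s hs _ => by
      simp only [pow_zero, Nat.factorial_zero, Nat.cast_one, div_one, zero_add]
      rw [one_div, ← div_eq_inv_mul, le_div_iff₀ (by positivity)]
      nlinarith
  refine key.trans (ENNReal.ofReal_le_ofReal ?_)
  norm_num at h
  set x := F f (n - 1)
  have h2 : (n : ℝ) ^ 8 * x ^ 7 ≤ x ^ 3 := by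
    calc (n : ℝ) ^ 8 * x ^ 7 = (n ^ 2 * x) ^ 4 * x ^ 3 := by ring
      _ ≤ 1 ^ 4 * x ^ 3 := by gcongr
      _ = x ^ 3 := by ring
  calc (n : ℝ) ^ (2 * 1) / (Nat.factorial 1 : ℕ) * (1 / x ^ 2 / x) = 2 * (n ^ 2 / (2 * x ^ 3)) := by
        simp
        field_simp
    _ ≤ 13122 * ((n ^ 6 * x ^ 2 + n ^ 2) / (n ^ 8 * x ^ 7 + x ^ 3)) := by
        gcongr
        · norm_num
        · have : 0 ≤ (n : ℝ) ^ 6 * x ^ 2 := by positivity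
          linarith
        · linarith

lemma lintegral_sum_excess_two_le {n : ℕ} (hn : 3 ≤ n) {f : Fin n → ℝ} (hf : ∀ i, 0 < f i) :
    ∫⁻ w, ENNReal.ofReal (∑ A ∈ Finset.powersetCard 2 Finset.univ, excess f 2 A w) ∂(weightLaw n) ≤
      ENNReal.ofReal (13122 * (((n : ℝ) ^ 10 * F f (n - 2) ^ 3 + (n : ℝ) ^ 4) /
      ((n : ℝ) ^ 14 * F f (n - 2) ^ 9 + F f (n - 2) ^ 2))) := by
  by_cases h : n ^ 2 * F f (n - 2) < ((2 : ℕ) : ℝ) ^ 2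
  swap
  · rw [lintegral_sum_excess_eq_zero h]
    exact zero_le
  have hn' : (3 : ℝ) ≤ n := by exact_mod_cast hn
  have hF : 0 < F f (n - 2) := F_pos hf (by omega) (by omega)
  have key := lintegral_sum_excess_le (f := f) (k := 2)
    (c := 1 / F f (n - 2) / F f (n - 2)) (by positivity) fun A hA =>
    lintegral_excess_le (j := 1) hA hF (by positivity) fun s hs _ => by
      simp only [pow_one, Nat.factorial_one, Nat.cast_one, div_one, Nat.reduceAdd]
      rw [one_div, ← div_eq_inv_mul, le_div_iff₀ (by positivity)]
      nlinarith
  refine key.trans (ENNReal.ofReal_le_ofReal ?_)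
  norm_num at h
  set x := F f (n - 2)
  -- `16384 = 4^7` comes from `n² x < 4`; it accounts for most of the slack in the common constant
  -- `13122`.
  have h2 : (n : ℝ) ^ 14 * x ^ 9 ≤ 16384 * x ^ 2 := by
    calc (n : ℝ) ^ 14 * x ^ 9 = (n ^ 2 * x) ^ 7 * x ^ 2 := by ring
      _ ≤ 4 ^ 7 * x ^ 2 := by gcongr
      _ = 16384 * x ^ 2 := by ring
  calc (n : ℝ) ^ (2 * 2) / (Nat.factorial 2 : ℕ) * (1 / x / x)
      = (16385 / 2) * (n ^ 4 / (16385 * x ^ 2)) := by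
        simp
        field_simp
    _ ≤ 13122 * ((n ^ 10 * x ^ 3 + n ^ 4) / (n ^ 14 * x ^ 9 + x ^ 2)) := by
        gcongr
        · norm_num
        · have : 0 ≤ (n : ℝ) ^ 10 * x ^ 3 := by positivity
          linarith
        · linarith

lemma pow_self_le_three_pow_mul_factorial (k : ℕ) : (k : ℝ) ^ k ≤ 3 ^ k * k.factorial := by
  have h := Real.pow_div_factorial_le_exp (x := k) (Nat.cast_nonneg k) k
  rw [div_le_iff₀ (by positivity)] at h
  refine h.trans ?_
  gcongr
  rw [← Real.exp_one_pow]
  gcongr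
  exact Real.exp_one_lt_three.le

lemma add_three_sq_le (j : ℕ) : ((j + 3 : ℕ) : ℝ) ^ 2 ≤ 9 * 2 ^ j := by
  induction j with
  | zero => norm_num
  | succ j ih =>
    rw [pow_succ (2 : ℝ) j]
    push_cast at ih ⊢
    have : (0 : ℝ) ≤ j := Nat.cast_nonneg j
    nlinarith

/-- Below the threshold, `s^(k-1) ≤ thresh^(k-3) (F + s)²`. In `18 = 9 * 2`, the powers of `9`
cancel the `9^k` of `k^(2k) ≤ 9^k (k!)²`, and the powers of `2` beat the leftover `k²`. The constant
is `13122 = 2 * 9 * 3^6`. -/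
lemma lintegral_sum_excess_ge_three_le {n : ℕ} {f : Fin n → ℝ} (hf : ∀ i, 0 < f i) {k : ℕ}
    (hk3 : 3 ≤ k) (hkn : k < n) :
    ∫⁻ w, ENNReal.ofReal (∑ A ∈ Finset.powersetCard k Finset.univ, excess f k A w) ∂(weightLaw n) ≤
      ENNReal.ofReal (13122 * (((k : ℝ) ^ 3 * (n : ℝ) ^ 12 * F f (n - k) ^ 3 +
        (k : ℝ) ^ 9 * (n : ℝ) ^ 6) /
        ((n : ℝ) ^ 16 * F f (n - k) ^ 9 + (k : ℝ) ^ 16 * F f (n - k)))) := by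
  by_cases h : n ^ 2 * F f (n - k) < (k : ℝ) ^ 2
  swap
  · rw [lintegral_sum_excess_eq_zero h]
    exact zero_le
  have hn : (0 : ℝ) < n := by exact_mod_cast (by omega : 0 < n)
  have hk : (0 : ℝ) < k := by exact_mod_cast (by omega : 0 < k)
  have hF : 0 < F f (n - k) := F_pos hf (by omega) (by omega)
  obtain ⟨j, rfl⟩ : ∃ j, k = j + 3 := ⟨k - 3, by omega⟩
  have ht : 0 ≤ thresh n (j + 3) := by unfold thresh; positivity
  have key := lintegral_sum_excess_le (f := f) (k := j + 3)
    (c := thresh n (j + 3) ^ j / (j + 2).factorial / F f (n - (j + 3))) (by positivity) fun A hA =>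
    lintegral_excess_le (j := j + 2) hA hF (by positivity) fun s hs hst => by
      rw [pow_add, div_mul_eq_mul_div]
      gcongr
      linarith
  refine key.trans (ENNReal.ofReal_le_ofReal ?_)
  set x := F f (n - (j + 3))
  have hfac : ((j + 3).factorial : ℝ) = ((j + 3 : ℕ) : ℝ) * (j + 2).factorial := by
    rw [Nat.factorial_succ]
    push_cast
    ring
  have h1 := pow_self_le_three_pow_mul_factorial (j + 3)
  have h2 := add_three_sq_le j
  set m : ℝ := ((j + 3 : ℕ) : ℝ) with hm
  set a : ℝ := ((j + 3).factorial : ℝ) with ha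
  have ha0 : 0 < a := by rw [ha]; positivity
  have h3 : (n : ℝ) ^ 16 * x ^ 9 + m ^ 16 * x ≤ 2 * m ^ 16 * x := by
    have : (n : ℝ) ^ 16 * x ^ 9 ≤ m ^ 16 * x := by
      calc (n : ℝ) ^ 16 * x ^ 9 = (n ^ 2 * x) ^ 8 * x := by ring
        _ ≤ (m ^ 2) ^ 8 * x := by gcongr
        _ = m ^ 16 * x := by ring
    linarith
  have h4 : m ^ (2 * j + 8) ≤ 6561 * 18 ^ j * a ^ 2 := by
    calc m ^ (2 * j + 8) = (m ^ (j + 3)) ^ 2 * m ^ 2 := by ring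
      _ ≤ (3 ^ (j + 3) * a) ^ 2 * (9 * 2 ^ j) := by gcongr
      _ = 6561 * ((3 ^ j) ^ 2 * 2 ^ j) * a ^ 2 := by ring
      _ = _ := by rw [← pow_mul, mul_comm j 2, pow_mul, ← mul_pow]; norm_num
  have hb : ((j + 2).factorial : ℝ) = a / m := by rw [hfac]; field_simp
  have htj : thresh n (j + 3) ^ j = m ^ (2 * j) / (18 ^ j * n ^ (2 * j)) := by
    rw [thresh, div_pow, mul_pow, ← pow_mul, ← pow_mul]
  calc (n : ℝ) ^ (2 * (j + 3)) / a * (thresh n (j + 3) ^ j / (j + 2).factorial / x)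
      = n ^ 6 * m ^ (2 * j + 8) / (18 ^ j * a ^ 2 * m ^ 7 * x) := by
        rw [hb, htj, show 2 * (j + 3) = 2 * j + 6 by ring, pow_add, pow_add]
        field_simp
    _ ≤ n ^ 6 * (6561 * 18 ^ j * a ^ 2) / (18 ^ j * a ^ 2 * m ^ 7 * x) := by gcongr
    _ = 13122 * (m ^ 9 * n ^ 6 / (2 * m ^ 16 * x)) := by
        field_simp
        norm_num
    _ ≤ _ := by
        gcongr
        have : 0 ≤ m ^ 3 * (n : ℝ) ^ 12 * x ^ 3 := by positivity
        linarith

/-- The sum of all the fourth powers cut off in `excess`. -/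
noncomputable def totalExcess {n : ℕ} (f : Fin n → ℝ) (w : Edge n → ℝ) : ℝ :=
  ∑ k ∈ Finset.Icc 1 (n - 1), ∑ A ∈ Finset.powersetCard k Finset.univ, excess f k A w

lemma totalExcess_nonneg {n : ℕ} (f : Fin n → ℝ) (w : Edge n → ℝ) : 0 ≤ totalExcess f w :=
  Finset.sum_nonneg fun _ _ => Finset.sum_nonneg fun _ _ => excess_nonneg _ _ _ _

lemma measurable_totalExcess {n : ℕ} (f : Fin n → ℝ) : Measurable (totalExcess f) := by
  unfold totalExcess
  exact Finset.measurable_fun_sum _ fun k _ => Finset.measurable_fun_sum _ fun A _ =>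
    measurable_excess f k A

lemma lintegral_totalExcess_le {n : ℕ} (hn : 3 ≤ n) {f : Fin n → ℝ} (hf : ∀ i, 0 < f i) :
    ∫⁻ w, ENNReal.ofReal (totalExcess f w) ∂(weightLaw n) ≤
      ENNReal.ofReal (13122 * rootSum f) := by
  have hpos : ∀ k, 0 ≤ F f k := fun k => Finset.sum_nonneg fun i _ => (hf i).le
  unfold totalExcess rootSum
  simp_rw [ENNReal.ofReal_sum_of_nonneg fun k _ => Finset.sum_nonneg fun A _ =>
    excess_nonneg f k A _]
  rw [lintegral_finsetSum _ fun k _ => (Finset.measurable_fun_sum _ fun A _ =>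
    measurable_excess f k A).ennreal_ofReal]
  rw [← Finset.sum_erase_add _ _ (show 1 ∈ Finset.Icc 1 (n - 1) by simp; omega),
    ← Finset.sum_erase_add _ _ (show 2 ∈ (Finset.Icc 1 (n - 1)).erase 1 by simp; omega)]
  have hset : ((Finset.Icc 1 (n - 1)).erase 1).erase 2 = Finset.Icc 3 (n - 1) := by
    ext k
    simp only [Finset.mem_erase, Finset.mem_Icc]
    omega
  have p1 := hpos (n - 1)
  have p2 := hpos (n - 2)
  have p3 : ∀ k : ℕ, 0 ≤ 13122 * (((k : ℝ) ^ 3 * (n : ℝ) ^ 12 * F f (n - k) ^ 3 +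
        (k : ℝ) ^ 9 * (n : ℝ) ^ 6) /
        ((n : ℝ) ^ 16 * F f (n - k) ^ 9 + (k : ℝ) ^ 16 * F f (n - k))) := fun k => by
    have := hpos (n - k)
    positivity
  rw [hset, mul_add, mul_add, Finset.mul_sum, ENNReal.ofReal_add (by positivity)
    (Finset.sum_nonneg fun k _ => p3 k), ENNReal.ofReal_add (by positivity) (by positivity),
    ENNReal.ofReal_sum_of_nonneg fun k _ => p3 k, add_comm, add_comm (Finset.sum _ _), ← add_assoc]
  gcongr with k hk
  · exact lintegral_sum_excess_one_le hn hf
  · exact lintegral_sum_excess_two_le hn hf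
  · rw [Finset.mem_Icc] at hk
    exact lintegral_sum_excess_ge_three_le hf hk.1 (by omega)

lemma rootSum_pos {n : ℕ} (hn : 3 ≤ n) {f : Fin n → ℝ} (hf : ∀ i, 0 < f i) : 0 < rootSum f := by
  have hn' : (3 : ℝ) ≤ n := by exact_mod_cast hn
  have h1 : 0 < F f (n - 1) := F_pos hf (by omega) (by omega)
  have h2 : 0 < F f (n - 2) := F_pos hf (by omega) (by omega)
  unfold rootSum
  refine add_pos_of_pos_of_nonneg (by positivity) (Finset.sum_nonneg fun k _ => ?_)
  have : 0 ≤ F f (n - k) := Finset.sum_nonneg fun i _ => (hf i).le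
  positivity

/-! ### Measurability and Cauchy-Schwarz. -/

lemma measurable_walkWeight {n : ℕ} {u v : Fin n} (p : (⊤ : SimpleGraph (Fin n)).Walk u v) :
    Measurable fun w : Edge n → ℝ => walkWeight w p := by
  unfold walkWeight
  generalize p.edges.attach = l
  induction l with
  | nil => simp
  | cons e l ih =>
    simp only [List.map_cons, List.sum_cons]
    exact (measurable_pi_apply _).add ih

lemma measurable_dist {n : ℕ} (u v : Fin n) : Measurable fun w : Edge n → ℝ => dist w u v :=
  Measurable.iInf fun _ => measurable_walkWeight _

lemma measurable_distTo {n : ℕ} (U : Finset (Fin n)) (v : Fin n) :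
    Measurable fun w : Edge n → ℝ => distTo w U v :=
  Measurable.iInf fun u => measurable_dist u.1 v

lemma measurable_cost {n : ℕ} (f : Fin n → ℝ) (U : Finset (Fin n)) :
    Measurable fun w : Edge n → ℝ => cost f w U :=
  measurable_const.add (Finset.measurable_fun_sum _ fun v _ =>
    measurable_distTo U v)

lemma measurable_OPT {n : ℕ} (f : Fin n → ℝ) : Measurable fun w : Edge n → ℝ => OPT f w :=
  Measurable.iInf fun U => measurable_cost f U.1

/-- A form of the Cauchy-Schwarz inequality. -/
lemma integrable_mul_and_integral_mul_le {Ω : Type*} [MeasurableSpace Ω] {μ : Measure Ω}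
    {X Y : Ω → ℝ} (hX : Measurable X) (hY : Measurable Y) (hX2 : Integrable (fun ω => X ω ^ 2) μ)
    (hY2 : Integrable (fun ω => Y ω ^ 2) μ) {a b : ℝ} (ha : 0 < a) (hb : 0 < b)
    (hXa : ∫ ω, X ω ^ 2 ∂μ ≤ a ^ 2) (hYb : ∫ ω, Y ω ^ 2 ∂μ ≤ b ^ 2) :
    Integrable (fun ω => X ω * Y ω) μ ∧ ∫ ω, X ω * Y ω ∂μ ≤ a * b := by
  have hint : Integrable (fun ω => X ω * Y ω) μ :=
    MemLp.integrable_mul ((memLp_two_iff_integrable_sq hX.aestronglyMeasurable).2 hX2)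
      ((memLp_two_iff_integrable_sq hY.aestronglyMeasurable).2 hY2)
  refine ⟨hint, ?_⟩
  -- Weighted AM-GM, with weights making both terms at most `a * b / 2` after integration.
  calc ∫ ω, X ω * Y ω ∂μ ≤ ∫ ω, (b / (2 * a) * X ω ^ 2 + a / (2 * b) * Y ω ^ 2) ∂μ := by
        refine integral_mono hint ((hX2.const_mul _).add (hY2.const_mul _)) fun ω => ?_
        have h : b / (2 * a) * X ω ^ 2 + a / (2 * b) * Y ω ^ 2 - X ω * Y ω =
            (b * X ω - a * Y ω) ^ 2 / (2 * a * b) := by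
          field_simp
          ring
        have h2 : 0 ≤ (b * X ω - a * Y ω) ^ 2 / (2 * a * b) := by positivity
        change X ω * Y ω ≤ _
        linarith
    _ = b / (2 * a) * ∫ ω, X ω ^ 2 ∂μ + a / (2 * b) * ∫ ω, Y ω ^ 2 ∂μ := by
        rw [integral_add (hX2.const_mul _) (hY2.const_mul _), integral_const_mul,
          integral_const_mul]
    _ ≤ b / (2 * a) * a ^ 2 + a / (2 * b) * b ^ 2 := by gcongr
    _ = a * b := by field_simp; ring

lemma integrable_and_integral_le_of_lintegral_le {Ω : Type*} [MeasurableSpace Ω] {μ : Measure Ω}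
    {X : Ω → ℝ} (hX : Measurable X) (h0 : ∀ ω, 0 ≤ X ω) {a : ℝ} (ha : 0 ≤ a)
    (h : ∫⁻ ω, ENNReal.ofReal (X ω) ∂μ ≤ ENNReal.ofReal a) :
    Integrable X μ ∧ ∫ ω, X ω ∂μ ≤ a := by
  constructor
  · refine ⟨hX.aestronglyMeasurable, ?_⟩
    rw [hasFiniteIntegral_iff_ofReal (Filter.Eventually.of_forall h0)]
    exact h.trans_lt ENNReal.ofReal_lt_top
  · rw [integral_eq_lintegral_of_nonneg_ae (Filter.Eventually.of_forall h0)
      hX.aestronglyMeasurable]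
    exact ENNReal.toReal_le_of_le_ofReal ha h

lemma OPT_ge {n : ℕ} (hn : 0 < n) {f : Fin n → ℝ} (hf : ∀ i, 0 < f i) (hmono : Monotone f)
    {w : Edge n → ℝ} (hw : ∀ e, 0 < w e) : F f 1 ≤ OPT f w := by
  obtain ⟨A, hA, hle⟩ := exists_edges_le_OPT hn hmono hw
  have h1 : F f 1 ≤ F f (n - A.card) := F_mono hf (by omega)
  have h2 : 0 ≤ ∑ e ∈ A, w e := Finset.sum_nonneg fun e _ => (hw e).le
  linarith

/-! ### The second moment of `1/OPT`. -/

/-- The larger of `1 / F_n ^ 2` and all the terms `C * maxTerm f k`. -/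
noncomputable def maxPart {n : ℕ} (C : ℝ) (f : Fin n → ℝ) : ℝ :=
  max (1 / F f n ^ 2) (⨆ k : {k : ℕ // k ∈ Finset.Icc 1 (n - 1)}, C * maxTerm f k.1)

lemma ratioBound_eq {n : ℕ} (C : ℝ) (f : Fin n → ℝ) :
    ratioBound C f = Real.sqrt (maxPart C f) + (C * rootSum f) ^ (1 / 4 : ℝ) := rfl

lemma le_maxPart {n : ℕ} (C : ℝ) (f : Fin n → ℝ) {k : ℕ} (h1 : 1 ≤ k) (h2 : k < n) :
    C * maxTerm f k ≤ maxPart C f :=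
  (le_ciSup (f := fun k : {k : ℕ // k ∈ Finset.Icc 1 (n - 1)} => C * maxTerm f k.1)
    (Set.finite_range _).bddAbove ⟨k, by rw [Finset.mem_Icc]; omega⟩).trans (le_max_right _ _)

/-- If `1 / OPT ^ 2` is not controlled by `maxPart`, then some set of edges is exceptionally
light. -/
lemma inv_OPT_sq_le {n : ℕ} (hn : 0 < n) {f : Fin n → ℝ} (hf : ∀ i, 0 < f i) (hmono : Monotone f)
    {C : ℝ} (hC : 648 ≤ C) {w : Edge n → ℝ} (hw : ∀ e, 0 < w e) :
    (1 / OPT f w) ^ 2 ≤ maxPart C f + Real.sqrt (totalExcess f w) := by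
  obtain ⟨A, hA, hle⟩ := exists_edges_le_OPT hn hmono hw
  have hF : 0 < F f (n - A.card) := F_pos hf (by omega) hn
  have hS : 0 ≤ ∑ e ∈ A, w e := Finset.sum_nonneg fun e _ => (hw e).le
  have hE := Real.sqrt_nonneg (totalExcess f w)
  have hOPT : (1 / OPT f w) ^ 2 ≤ 1 / (F f (n - A.card) + ∑ e ∈ A, w e) ^ 2 := by
    rw [div_pow, one_pow]
    gcongr
  rcases A.card.eq_zero_or_pos with h0 | h0
  · have : 1 / (F f (n - A.card) + ∑ e ∈ A, w e) ^ 2 ≤ 1 / F f n ^ 2 := by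
      rw [h0, Nat.sub_zero] at hF ⊢
      gcongr
      linarith
    have hM : 1 / F f n ^ 2 ≤ maxPart C f := le_max_left _ _
    linarith
  have hlt : A.card < n := by omega
  have hmax := le_maxPart C f h0 hlt
  have hmt := maxTerm_nonneg hf A.card
  by_cases hs : n ^ 2 * F f (n - A.card) < (A.card : ℝ) ^ 2
  swap
  · have h1 := inv_F_sq_le_maxTerm hf hlt (not_lt.1 hs)
    have h2 : 1 / (F f (n - A.card) + ∑ e ∈ A, w e) ^ 2 ≤ 1 / F f (n - A.card) ^ 2 := by
      gcongr
      linarith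
    nlinarith
  by_cases ht : ∑ e ∈ A, w e < thresh n A.card
  · have h1 : excess f A.card A w ≤ totalExcess f w := by
      unfold totalExcess
      refine le_trans ?_ (Finset.single_le_sum (f := fun k =>
        ∑ A ∈ Finset.powersetCard k Finset.univ, excess f k A w)
        (fun k _ => Finset.sum_nonneg fun A _ => excess_nonneg f k A w)
        (Finset.mem_Icc.2 ⟨h0, hA⟩))
      exact Finset.single_le_sum (f := fun A' => excess f A.card A' w)
        (fun A' _ => excess_nonneg f _ A' w) (by simp)
    have h2 : 1 / (F f (n - A.card) + ∑ e ∈ A, w e) ^ 2 ≤ Real.sqrt (totalExcess f w) := by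
      refine Real.le_sqrt_of_sq_le (le_trans (le_of_eq ?_) h1)
      rw [excess, if_pos ⟨hs, ht⟩, div_pow, one_pow, ← pow_mul]
    have : 0 ≤ C * maxTerm f A.card := mul_nonneg (by linarith) hmt
    linarith
  · have h1 := inv_thresh_sq_le_maxTerm hf hlt h0 hs
    have hn' : (0 : ℝ) < n := by exact_mod_cast hn
    have hk' : (0 : ℝ) < A.card := by exact_mod_cast h0
    have hth : 0 < thresh n A.card := by unfold thresh; positivity
    have h2 : 1 / (F f (n - A.card) + ∑ e ∈ A, w e) ^ 2 ≤ 1 / thresh n A.card ^ 2 := by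
      gcongr
      linarith [not_lt.1 ht]
    nlinarith

lemma maxPart_pos {n : ℕ} (hn : 0 < n) {C : ℝ} {f : Fin n → ℝ} (hf : ∀ i, 0 < f i) :
    0 < maxPart C f := by
  have := F_pos hf hn hn
  exact lt_of_lt_of_le (by positivity) (le_max_left _ _)

lemma ratioBound_pos {n : ℕ} (hn : 3 ≤ n) {C : ℝ} (hC : 0 ≤ C) {f : Fin n → ℝ}
    (hf : ∀ i, 0 < f i) : 0 < ratioBound C f := by
  have h1 := rootSum_pos hn hf
  have h2 := Real.sqrt_pos.2 (maxPart_pos (C := C) (by omega) hf)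
  rw [ratioBound_eq]
  positivity

lemma integral_inv_OPT_sq_le {n : ℕ} (hn : 3 ≤ n) {f : Fin n → ℝ} (hf : ∀ i, 0 < f i)
    (hmono : Monotone f) :
    Integrable (fun w => (1 / OPT f w) ^ 2) (weightLaw n) ∧
      ∫ w, (1 / OPT f w) ^ 2 ∂(weightLaw n) ≤ ratioBound 13122 f ^ 2 := by
  have hn0 : 0 < n := by omega
  have hR := rootSum_pos hn hf
  have hM := maxPart_pos (C := 13122) hn0 hf
  have hB : 0 < 13122 * rootSum f := by positivity
  have hF1 : 0 < F f 1 := F_pos hf one_pos hn0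
  have hmeas : Measurable fun w : Edge n → ℝ => (1 / OPT f w) ^ 2 :=
    ((measurable_OPT f).const_div 1).pow_const 2
  -- At least one facility is opened, so `OPT ≥ F_1 > 0` almost surely and `1/OPT` is bounded.
  have hint : Integrable (fun w => (1 / OPT f w) ^ 2) (weightLaw n) := by
    refine Integrable.of_bound hmeas.aestronglyMeasurable ((1 / F f 1) ^ 2) ?_
    filter_upwards [ae_weight_pos n] with w hw
    rw [Real.norm_of_nonneg (by positivity)]
    have h := OPT_ge hn0 hf hmono hw
    have h2 : 0 < OPT f w := hF1.trans_le h
    gcongr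
  refine ⟨hint, ?_⟩
  obtain ⟨hTi, hTb⟩ := integrable_and_integral_le_of_lintegral_le (measurable_totalExcess f)
    (totalExcess_nonneg f) hB.le (lintegral_totalExcess_le hn hf)
  have hsq : ∀ w : Edge n → ℝ, Real.sqrt (totalExcess f w) ^ 2 = totalExcess f w :=
    fun w => Real.sq_sqrt (totalExcess_nonneg f w)
  -- Cauchy-Schwarz against the constant `1`: the mean of the root is at most the root of the mean.
  obtain ⟨hsi, hsb⟩ := integrable_mul_and_integral_mul_le (μ := weightLaw n)
    (X := fun w => Real.sqrt (totalExcess f w)) (Y := fun _ => 1)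
    (measurable_totalExcess f).sqrt measurable_const (by simpa only [hsq] using hTi)
    (integrable_const _) (Real.sqrt_pos.2 hB) one_pos
    (by simpa only [hsq, Real.sq_sqrt hB.le] using hTb) (by simp)
  simp only [mul_one] at hsi hsb
  calc ∫ w, (1 / OPT f w) ^ 2 ∂(weightLaw n)
      ≤ ∫ w, (maxPart 13122 f + Real.sqrt (totalExcess f w)) ∂(weightLaw n) := by
        refine integral_mono_ae hint ((integrable_const _).add hsi) ?_
        filter_upwards [ae_weight_pos n] with w hw
        exact inv_OPT_sq_le hn0 hf hmono (by norm_num) hw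
    _ = maxPart 13122 f + ∫ w, Real.sqrt (totalExcess f w) ∂(weightLaw n) := by
        rw [integral_add (integrable_const _) hsi]
        simp
    _ ≤ maxPart 13122 f + Real.sqrt (13122 * rootSum f) := by gcongr
    -- With `M = maxPart` and `R = 13122 * rootSum`, this is `M + √R ≤ (√M + R^(1/4))²`.
    _ ≤ ratioBound 13122 f ^ 2 := by
        have h4 : ((13122 * rootSum f) ^ (1 / 4 : ℝ)) ^ 2 = Real.sqrt (13122 * rootSum f) := by
          rw [Real.sqrt_eq_rpow, ← Real.rpow_natCast, ← Real.rpow_mul hB.le]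
          norm_num
        rw [ratioBound_eq, add_sq, h4, Real.sq_sqrt hM.le]
        have : 0 ≤ 2 * Real.sqrt (maxPart 13122 f) * (13122 * rootSum f) ^ (1 / 4 : ℝ) := by
          positivity
        linarith

/-! ### Absorbing constant factors into `C`. -/

/-- A constant factor is absorbed by the constant of the O-notation. -/
lemma mul_ratioBound_le {n : ℕ} (hn : 3 ≤ n) {f : Fin n → ℝ} (hf : ∀ i, 0 < f i) {a C C' : ℝ}
    (ha : 1 ≤ a) (hC : 0 ≤ C) (hCC' : a ^ 4 * C ≤ C')
    (h : a ^ 2 / F f n ^ 2 ≤ max (1 / F f n ^ 2) (C' * maxTerm f 1)) :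
    a * ratioBound C f ≤ ratioBound C' f := by
  have hR := (rootSum_pos hn hf).le
  have h24 : a ^ 2 * C ≤ C' := by
    refine le_trans ?_ hCC'
    gcongr
    · norm_num
  rw [ratioBound_eq, ratioBound_eq, mul_add]
  gcongr ?_ + ?_
  · have hsq : a * Real.sqrt (maxPart C f) = Real.sqrt (a ^ 2 * maxPart C f) := by
      rw [Real.sqrt_mul (sq_nonneg _), Real.sqrt_sq (by linarith)]
    rw [hsq]
    refine Real.sqrt_le_sqrt ?_
    conv_lhs => rw [maxPart]
    rw [mul_max_of_nonneg _ _ (sq_nonneg a)]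
    refine max_le ?_ ?_
    -- The entry `1/F_n²` has no `C` to enlarge, which is why `h` is assumed.
    · rw [mul_one_div]
      exact h.trans (max_le (le_max_left _ _) (le_maxPart C' f le_rfl (by omega)))
    · have : Nonempty {k : ℕ // k ∈ Finset.Icc 1 (n - 1)} :=
        ⟨⟨1, by rw [Finset.mem_Icc]; omega⟩⟩
      obtain ⟨⟨k, hk⟩, hk'⟩ := exists_eq_ciSup_of_finite
        (f := fun k : {k : ℕ // k ∈ Finset.Icc 1 (n - 1)} => C * maxTerm f k.1)
      rw [← hk', ← mul_assoc]
      rw [Finset.mem_Icc] at hk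
      exact (mul_le_mul_of_nonneg_right h24 (maxTerm_nonneg hf k)).trans
        (le_maxPart C' f hk.1 (by omega))
  · have h4 : a = (a ^ 4) ^ (1 / 4 : ℝ) := by
      rw [← Real.rpow_natCast, ← Real.rpow_mul (by linarith)]
      norm_num
    conv_lhs => rw [h4]
    rw [← Real.mul_rpow (by positivity) (by positivity), ← mul_assoc]
    gcongr

/-! ### The threshold `κ` and the second moment of the greedy cost. -/

lemma kappa_le {n : ℕ} (f : Fin n → ℝ) : kappa f ≤ n := by
  classical
  exact Finset.sup_le fun j _ => j.2

lemma kappa_spec {n : ℕ} {f : Fin n → ℝ} (h : 2 ≤ kappa f) :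
    ∃ j : Fin n, j.val + 1 = kappa f ∧ f j < 1 / (j.val : ℝ) := by
  classical
  have hne : (Finset.univ.filter fun j : Fin n => j.val = 0 ∨ f j < 1 / (j.val : ℝ)).Nonempty := by
    by_contra hne
    rw [Finset.not_nonempty_iff_eq_empty] at hne
    have h0 : kappa f = 0 := by
      unfold kappa
      convert congrArg (fun s : Finset (Fin n) => s.sup fun j => j.val + 1) hne
      simp
    omega
  obtain ⟨j, hj, hj'⟩ := Finset.exists_mem_eq_sup _ hne fun j : Fin n => j.val + 1
  have hk : kappa f = j.val + 1 := by
    rw [← hj']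
    unfold kappa
    congr!
  refine ⟨j, hk.symm, ?_⟩
  rcases (Finset.mem_filter.1 hj).2 with h0 | h0
  · omega
  · exact h0

/-- If `κ < n`, the most expensive facility alone costs at least `1/(n-1)`. -/
lemma inv_le_F_of_kappa_lt {n : ℕ} {f : Fin n → ℝ} (hf : ∀ i, 0 < f i) (h : kappa f < n)
    (hn : 2 ≤ n) : 1 / (n : ℝ) ≤ F f n := by
  classical
  have hn' : (2 : ℝ) ≤ n := by exact_mod_cast hn
  let j : Fin n := ⟨n - 1, by omega⟩
  have hj : ¬ (j.val = 0 ∨ f j < 1 / (j.val : ℝ)) := by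
    intro hj
    have : j.val + 1 ≤ kappa f :=
      Finset.le_sup (f := fun j : Fin n => j.val + 1) (by simpa using hj)
    simp only [j] at this
    omega
  push Not at hj
  have h1 : f j ≤ F f n := by
    rw [F_self]
    exact Finset.single_le_sum (f := f) (fun i _ => (hf i).le) (Finset.mem_univ j)
  refine le_trans ?_ (hj.2.trans h1)
  have h2 : ((n - 1 : ℕ) : ℝ) = n - 1 := by rw [Nat.cast_sub (by omega)]; simp
  simp only [j, h2]
  exact one_div_le_one_div_of_le (by linarith) (by linarith)

lemma sum_greedy_le {n : ℕ} {f : Fin n → ℝ} (hmono : Monotone f)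
    {U : Finset (Fin n)} (hU : IsGreedy f U) (h : 2 ≤ kappa f) : ∑ u ∈ U, f u ≤ 2 := by
  classical
  obtain ⟨j, hj, hfj⟩ := kappa_spec h
  have hle : ∀ u ∈ U, f u ≤ f j := by
    intro u hu
    by_cases huj : u ≤ j
    · exact hmono huj
    -- Since `U` has `j + 1` elements and contains `u > j`, it misses some `v ≤ j`; greediness then
    -- gives `f u ≤ f v ≤ f j`.
    · have : ∃ v : Fin n, v ≤ j ∧ v ∉ U := by
        by_contra hcon
        push Not at hcon
        have hsub : insert u (Finset.Iic j) ⊆ U := by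
          intro x hx
          rcases Finset.mem_insert.1 hx with rfl | hx
          · exact hu
          · exact hcon x (Finset.mem_Iic.1 hx)
        have hc := Finset.card_le_card hsub
        rw [Finset.card_insert_of_notMem (by simpa using huj), Fin.card_Iic, hU.1] at hc
        omega
      obtain ⟨v, hv, hvU⟩ := this
      exact (hU.2 u hu v hvU).trans (hmono hv)
  have hj1 : 1 ≤ j.val := by omega
  have hj1' : (1 : ℝ) ≤ j.val := by exact_mod_cast hj1
  calc ∑ u ∈ U, f u ≤ U.card • f j := Finset.sum_le_card_nsmul _ _ _ hle
    _ = (j.val + 1) * f j := by rw [hU.1, ← hj, nsmul_eq_mul]; push_cast; ring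
    _ ≤ (j.val + 1) * (1 / j.val) := by gcongr
    _ ≤ 2 := by
      rw [mul_one_div, div_le_iff₀ (by linarith)]
      linarith

lemma distTo_eq_zero_of_mem {n : ℕ} {w : Edge n → ℝ} (hw : ∀ e, 0 < w e) {U : Finset (Fin n)}
    {v : Fin n} (hv : v ∈ U) : distTo w U v = 0 :=
  le_antisymm ((distTo_le w hv v).trans (dist_self_le w v)) (distTo_nonneg hw U v)

/-- The direct edges from `U` to `v ∉ U` are `|U|` distinct edges, and their minimum weight bounds
the distance. -/
lemma lintegral_distTo_sq_le {n : ℕ} {U : Finset (Fin n)} (hU : U.Nonempty) (v : Fin n) :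
    ∫⁻ w, ENNReal.ofReal (distTo w U v ^ 2) ∂(weightLaw n) ≤
      ENNReal.ofReal (2 / (U.card : ℝ) ^ 2) := by
  have : Nonempty {u : Fin n // u ∈ U} := hU.to_subtype
  by_cases hv : v ∈ U
  · have h0 : ∫⁻ w, ENNReal.ofReal (distTo w U v ^ 2) ∂(weightLaw n) =
        ∫⁻ w, 0 ∂(weightLaw n) := by
      refine lintegral_congr_ae ?_
      filter_upwards [ae_weight_pos n] with w hw
      simp [distTo_eq_zero_of_mem hw hv]
    rw [h0, lintegral_zero]
    exact zero_le
  · have hadj : ∀ u : {u : Fin n // u ∈ U}, (⊤ : SimpleGraph (Fin n)).Adj u.1 v := by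
      rintro ⟨u, hu⟩
      simp only [SimpleGraph.top_adj]
      rintro rfl
      exact hv hu
    let j : {u : Fin n // u ∈ U} → Edge n := fun u => ⟨s(u.1, v), hadj u⟩
    have hj : Function.Injective j := by
      intro a b hab
      have : s(a.1, v) = s(b.1, v) := congrArg Subtype.val hab
      exact Subtype.ext (Sym2.congr_left.1 this)
    calc ∫⁻ w, ENNReal.ofReal (distTo w U v ^ 2) ∂(weightLaw n)
        ≤ ∫⁻ w, ENNReal.ofReal ((⨅ u, w (j u)) ^ 2) ∂(weightLaw n) := by
          refine lintegral_mono_ae ?_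
          filter_upwards [ae_weight_pos n] with w hw
          have h0 := distTo_nonneg hw U v
          gcongr
          exact ciInf_mono (Set.finite_range _).bddBelow fun u => dist_le_weight w (hadj u)
      _ ≤ ENNReal.ofReal (2 / (Fintype.card {u : Fin n // u ∈ U} : ℝ) ^ 2) :=
          lintegral_sq_min_weight_le j hj
      _ = _ := by rw [Fintype.card_coe]

lemma cost_greedy_sq_le {n : ℕ} {f : Fin n → ℝ} (hf : ∀ i, 0 < f i) (hmono : Monotone f)
    (hκ2 : 2 ≤ kappa f) {U : Finset (Fin n)} (hU : IsGreedy f U) (w : Edge n → ℝ) :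
    cost f w U ^ 2 ≤ 8 + 2 * n * ∑ v, distTo w U v ^ 2 := by
  have h1 := sum_greedy_le hmono hU hκ2
  have h2 : 0 ≤ ∑ u ∈ U, f u := Finset.sum_nonneg fun u _ => (hf u).le
  have h3 : (∑ v, distTo w U v) ^ 2 ≤ n * ∑ v, distTo w U v ^ 2 := by
    have := sq_sum_le_card_mul_sum_sq (s := Finset.univ) (f := fun v => distTo w U v)
    simpa using this
  have h4 : (∑ u ∈ U, f u) ^ 2 ≤ 2 ^ 2 := by gcongr
  rw [cost_eq]
  generalize ∑ u ∈ U, f u = a at *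
  generalize ∑ v, distTo w U v = b at *
  generalize ∑ v, distTo w U v ^ 2 = d at *
  linarith [sq_nonneg (a - b), add_sq a b, sub_sq a b]

lemma lintegral_sum_distTo_sq_le {n : ℕ} {U : Finset (Fin n)} (hU : U.Nonempty) :
    ∫⁻ w, ENNReal.ofReal (∑ v, distTo w U v ^ 2) ∂(weightLaw n) ≤
      ENNReal.ofReal (n * (2 / (U.card : ℝ) ^ 2)) := by
  have hmd : ∀ v, Measurable fun w : Edge n → ℝ => ENNReal.ofReal (distTo w U v ^ 2) := fun v =>
    ((measurable_distTo U v).pow_const 2).ennreal_ofReal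
  simp_rw [ENNReal.ofReal_sum_of_nonneg fun v _ => sq_nonneg (distTo _ U v)]
  rw [lintegral_finsetSum _ fun v _ => hmd v]
  refine (Finset.sum_le_sum fun v _ => lintegral_distTo_sq_le hU v).trans_eq ?_
  rw [Finset.sum_const, Finset.card_univ, Fintype.card_fin, nsmul_eq_mul,
    ENNReal.ofReal_mul (Nat.cast_nonneg n), ENNReal.ofReal_natCast]

lemma integral_cost_greedy_sq_le {n : ℕ} (hn : 0 < n) {f : Fin n → ℝ} (hf : ∀ i, 0 < f i)
    (hmono : Monotone f) {c : ℝ} (hc : 0 < c) (hκ : c * n ≤ kappa f) (hκ2 : 2 ≤ kappa f)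
    {U : Finset (Fin n)} (hU : IsGreedy f U) :
    Integrable (fun w => cost f w U ^ 2) (weightLaw n) ∧
      ∫ w, cost f w U ^ 2 ∂(weightLaw n) ≤ 8 + 4 / c ^ 2 := by
  have hn' : (0 : ℝ) < n := by exact_mod_cast hn
  have hUne : U.Nonempty := by rw [← Finset.card_pos, hU.1]; omega
  have hmeas : Measurable fun w : Edge n → ℝ => ∑ v, distTo w U v ^ 2 :=
    Finset.measurable_fun_sum _ fun v _ =>
      (measurable_distTo U v).pow_const 2
  obtain ⟨hDi, hDb⟩ := integrable_and_integral_le_of_lintegral_le hmeas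
    (fun w => Finset.sum_nonneg fun v _ => sq_nonneg _) (by positivity)
    (lintegral_sum_distTo_sq_le hUne)
  have hpt := cost_greedy_sq_le hf hmono hκ2 hU
  have hgi : Integrable (fun w => 8 + 2 * n * ∑ v, distTo w U v ^ 2) (weightLaw n) :=
    (integrable_const _).add (hDi.const_mul _)
  have hint : Integrable (fun w => cost f w U ^ 2) (weightLaw n) := by
    refine hgi.mono' ((measurable_cost f U).pow_const 2).aestronglyMeasurable ?_
    refine Filter.Eventually.of_forall fun w => ?_
    rw [Real.norm_of_nonneg (sq_nonneg _)]
    exact hpt w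
  refine ⟨hint, (integral_mono hint hgi hpt).trans ?_⟩
  rw [integral_add (integrable_const _) (hDi.const_mul _), integral_const_mul, integral_const,
    probReal_univ, one_smul]
  have hκ0 : (0 : ℝ) < kappa f := lt_of_lt_of_le (by positivity) hκ
  rw [hU.1] at hDb
  generalize (kappa f : ℝ) = κ at *
  have hsq : (c * n) ^ 2 ≤ κ ^ 2 := by gcongr
  have hfrac : 4 * (n : ℝ) ^ 2 / κ ^ 2 ≤ 4 / c ^ 2 := by
    rw [div_le_div_iff₀ (by positivity) (by positivity)]
    linarith [mul_pow c (n : ℝ) 2]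
  have hmul := mul_le_mul_of_nonneg_left hDb (show 0 ≤ 2 * (n : ℝ) by positivity)
  have heq : 2 * (n : ℝ) * (n * (2 / κ ^ 2)) = 4 * n ^ 2 / κ ^ 2 := by ring
  linarith

lemma cost_univ {n : ℕ} (f : Fin n → ℝ) {w : Edge n → ℝ} (hw : ∀ e, 0 < w e) :
    cost f w Finset.univ = F f n := by
  rw [cost_eq, F_self, Finset.sum_eq_zero fun v _ => distTo_eq_zero_of_mem hw (Finset.mem_univ v),
    add_zero]

end FacLoc

/-! ### Assembling the bound. -/

theorem theorem2 :
    ∀ c : ℝ, 0 < c → ∃ C : ℝ, 0 < C ∧ ∃ N : ℕ, ∀ n : ℕ, N ≤ n →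
      ∀ f : Fin n → ℝ, (∀ i, 0 < f i) → Monotone f → c * n ≤ FacLoc.kappa f →
      ∀ U : Finset (Fin n), FacLoc.IsGreedy f U →
        Integrable (fun w => FacLoc.cost f w U / FacLoc.OPT f w) (FacLoc.weightLaw n) ∧
        ∫ w, FacLoc.cost f w U / FacLoc.OPT f w ∂(FacLoc.weightLaw n) ≤
          FacLoc.ratioBound C f ∧
        (FacLoc.kappa f = n →
          ∫ w, FacLoc.cost f w U / FacLoc.OPT f w ∂(FacLoc.weightLaw n) ≤
            FacLoc.F f n * FacLoc.ratioBound C f) := by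
  intro c hc
  set L : ℝ := Real.sqrt (8 + 4 / c ^ 2) with hL
  have hL2 : L ^ 2 = 8 + 4 / c ^ 2 := Real.sq_sqrt (by positivity)
  have hLge : 2 ≤ L := Real.le_sqrt_of_sq_le (by
    have : 0 < 4 / c ^ 2 := by positivity
    linarith)
  have hC0 : (13122 : ℝ) ≤ L ^ 4 * 13122 := by
    have : 1 ≤ L ^ 4 := one_le_pow₀ (by linarith)
    linarith
  -- The factor `L` enters the fourth root as `L^4`; `n ≥ 2/c` forces `κ ≥ 2`.
  refine ⟨L ^ 4 * 13122, by positivity, max 3 ⌈2 / c⌉₊, ?_⟩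
  intro n hn f hf hmono hκ U hU
  have hn3 : 3 ≤ n := le_of_max_le_left hn
  have hn2c : 2 / c ≤ n := (Nat.le_ceil _).trans (by exact_mod_cast le_of_max_le_right hn)
  have hκ2 : 2 ≤ FacLoc.kappa f := by
    have h1 : (2 : ℝ) ≤ c * n := by rwa [div_le_iff₀' hc] at hn2c
    exact_mod_cast h1.trans hκ
  have hn0 : 0 < n := by omega
  have hmeas : Measurable fun w : FacLoc.Edge n → ℝ => 1 / FacLoc.OPT f w :=
    (FacLoc.measurable_OPT f).const_div 1
  have hB := FacLoc.ratioBound_pos (C := 13122) hn3 (by norm_num) hf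
  obtain ⟨hOi, hOb⟩ := FacLoc.integral_inv_OPT_sq_le hn3 hf hmono
  obtain ⟨hAi, hAb⟩ := FacLoc.integral_cost_greedy_sq_le hn0 hf hmono hc hκ hκ2 hU
  obtain ⟨hRi, hRb⟩ := FacLoc.integrable_mul_and_integral_mul_le (FacLoc.measurable_cost f U)
    hmeas hAi hOi (by linarith) hB (hAb.trans_eq hL2.symm) hOb
  simp only [mul_one_div] at hRi hRb
  have habsorb : 1 / (n : ℝ) ≤ FacLoc.F f n →
      L * FacLoc.ratioBound 13122 f ≤ FacLoc.ratioBound (L ^ 4 * 13122) f := by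
    intro h
    refine FacLoc.mul_ratioBound_le hn3 hf (by linarith) (by norm_num) le_rfl
      (le_max_of_le_right ?_)
    have h1 := FacLoc.inv_F_sq_le_maxTerm_one hf (by omega) h
    have h2 := FacLoc.maxTerm_nonneg hf 1
    calc L ^ 2 / FacLoc.F f n ^ 2 = L ^ 2 * (1 / FacLoc.F f n ^ 2) := by rw [mul_one_div]
      _ ≤ L ^ 2 * (2 * FacLoc.maxTerm f 1) := by gcongr
      _ = L ^ 2 * 2 * FacLoc.maxTerm f 1 := by ring
      _ ≤ L ^ 4 * 13122 * FacLoc.maxTerm f 1 := by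
        gcongr
        · linarith
        · norm_num
        · norm_num
  have hall : FacLoc.kappa f = n → ∫ w, FacLoc.cost f w U / FacLoc.OPT f w ∂(FacLoc.weightLaw n) ≤
      FacLoc.F f n * FacLoc.ratioBound (L ^ 4 * 13122) f := by
    intro hκn
    have hUuniv : U = Finset.univ := by
      rw [← Finset.card_eq_iff_eq_univ, hU.1, hκn, Fintype.card_fin]
    have hmonoC : FacLoc.ratioBound 13122 f ≤ FacLoc.ratioBound (L ^ 4 * 13122) f := by
      have := FacLoc.mul_ratioBound_le (C := 13122) (C' := L ^ 4 * 13122) hn3 hf le_rfl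
        (by norm_num) (by linarith) (by rw [one_pow]; exact le_max_left _ _)
      linarith
    obtain ⟨-, h1⟩ := FacLoc.integrable_mul_and_integral_mul_le (μ := FacLoc.weightLaw n)
      (X := fun _ => 1) measurable_const hmeas (integrable_const _) hOi one_pos hB (by simp) hOb
    simp only [one_mul] at h1
    have hF := FacLoc.F_pos hf hn0 hn0
    calc ∫ w, FacLoc.cost f w U / FacLoc.OPT f w ∂(FacLoc.weightLaw n)
        = ∫ w, FacLoc.F f n * (1 / FacLoc.OPT f w) ∂(FacLoc.weightLaw n) := by
          refine integral_congr_ae ?_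
          filter_upwards [FacLoc.ae_weight_pos n] with w hw
          rw [hUuniv, FacLoc.cost_univ f hw, mul_one_div]
      _ = FacLoc.F f n * ∫ w, 1 / FacLoc.OPT f w ∂(FacLoc.weightLaw n) := integral_const_mul _ _
      _ ≤ FacLoc.F f n * FacLoc.ratioBound (L ^ 4 * 13122) f := by
          gcongr
          exact h1.trans hmonoC
  refine ⟨hRi, ?_, hall⟩
  -- If `F_n < 1/n`, then `κ = n` and the stronger bound, with its factor `F_n ≤ 1`, already
  -- suffices.
  by_cases hF1 : 1 / (n : ℝ) ≤ FacLoc.F f n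
  · exact hRb.trans (habsorb hF1)
  · have hκn : FacLoc.kappa f = n := by
      by_contra hne
      exact hF1 (FacLoc.inv_le_F_of_kappa_lt hf
        (lt_of_le_of_ne (FacLoc.kappa_le f) hne) (by omega))
    refine (hall hκn).trans (mul_le_of_le_one_left
      (FacLoc.ratioBound_pos hn3 (by positivity) hf).le ?_)
    refine (not_le.1 hF1).le.trans ?_
    rw [div_le_one (by exact_mod_cast hn0)]
    exact_mod_cast hn0
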